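/- For $p,q\in\mathbb{C}$ and $\tau$ in the upper half-plane $\mathbb{H}$ let $$\vartheta[p,q](\tau)=\sum_{m\in\mathbb{Z}}\exp\bigl(\pi i(m+p)^2\tau+2\pi i(m+p)q\bigr),$$ and let $\partial_q\vartheta[p,q](\tau)$ be its partial derivative in $q$. Let the permutations $\tilde S(p,q)=(-q,p)$ and $\tilde T(p,q)=(p,q+p+\tfrac12)$ act on $(\mathbb{R}/\mathbb{Z})^2$, identified with $[0,1)^2$, and for real $p,q$ let $\mathcal{O}_{(p,q)}\subset[0,1)^2$ be the orbit of $(p,q)$ under the group generated by $\tilde S$ and $\tilde T$. Suppose that $\mathcal{O}_{(p,q)}$ is finite, with $n$ elements, and that $\mathcal{O}_{(p,q)}\neq\{(\frac12,\frac12)\}$ and $\mathcal{O}_{(p,q)}\neq\{(0,0),(\frac12,0),(0,\frac12)\}$. Let $n_0$ be the number of points $(p',q')\in\mathcal{O}_{(p,q)}$ with $p'=0$. Then $n$ is even. Moreover, for every $(p',q')\in\mathcal{O}_{(p,q)}$ the function $\tau\mapsto\partial_q\vartheta[p',q'](\tau)$ is holomorphic on $\mathbb{H}$ and does not vanish identically.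 Let $v_\tau[p',q']$ denote its order of vanishing at $\tau\in\mathbb{H}$, let $\rho=e^{2\pi i/3}$, and let $R\subset\mathbb{H}$ be any set that contains exactly one point of each $PSL_2(\mathbb{Z})$-orbit on $\mathbb{H}$. Then each $\partial_q\vartheta[p',q']$ with $(p',q')\in\mathcal{O}_{(p,q)}$ has only finitely many zeros in $R$, and $$\sum_{(p',q')\in\mathcal{O}_{(p,q)}}\Bigl(\tfrac12 v_i[p',q']+\tfrac13 v_\rho[p',q']+\sum_{P\in R}{}^{\!*}\,v_P[p',q']\Bigr)=\frac{n}{12}-\frac{n_0}{2},$$ where the starred sum excludes the points of $R$ that are $PSL_2(\mathbb{Z})$-equivalent to $i$ or to $\rho$. -/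

import Mathlib

open scoped MatrixGroups

noncomputable section

namespace BianchiIX

/-- The theta function with characteristics `ϑ[p,q](z, τ)`, with `τ = iμ` in the upper half-plane:
`∑ₘ exp (π i (m + p)² τ + 2 π i (m + p) (z + q))`, the sum being over all integers `m`. -/
def thetaChar (p q z τ : ℂ) : ℂ :=
  ∑' m : ℤ, Complex.exp (Real.pi * Complex.I * (m + p) ^ 2 * τ
    + 2 * Real.pi * Complex.I * (m + p) * (z + q))

/-- The derivative `∂_q ϑ[p,q](τ)` of `ϑ[p,q](τ) = ϑ[p,q](0, τ)` in the characteristic `q`. -/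
def dqTheta (p q τ : ℂ) : ℂ :=
  deriv (fun q' : ℂ => thetaChar p q' 0 τ) q

/-- The torus `(ℝ/ℤ)²` of parameters `(p, q)`. -/
abbrev Param : Type := UnitAddCircle × UnitAddCircle

/-- The representative in `[0,1)` of a class modulo 1. -/
def rep (a : UnitAddCircle) : ℝ := (AddCircle.equivIco (1 : ℝ) 0 a : ℝ)

/-- The class of `1/2` modulo 1. -/
def half : UnitAddCircle := ((1 / 2 : ℝ) : UnitAddCircle)

/-- The permutation `(p, q) ↦ (-q, p)` of the parameters. -/
def permS : Equiv.Perm Param where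
  toFun x := (-x.2, x.1)
  invFun x := (x.2, -x.1)
  left_inv x := by simp
  right_inv x := by simp

/-- The permutation `(p, q) ↦ (p, q + p + 1/2)` of the parameters. -/
def permT : Equiv.Perm Param where
  toFun x := (x.1, x.2 + x.1 + half)
  invFun x := (x.1, x.2 - x.1 - half)
  left_inv x := Prod.ext rfl (by dsimp only; abel)
  right_inv x := Prod.ext rfl (by dsimp only; abel)

/-- The orbit of the parameter `x` under the group generated by the two permutations,
that is, under the action of the modular group on parameters. -/
def paramOrbit (x : Param) : Set Param :=
  MulAction.orbit (Subgroup.closure ({permS, permT} : Set (Equiv.Perm Param))) x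

/-- `∂_q ϑ[p',q']` as a function of `τ`, for `(p', q') ∈ [0,1)²` representing `x`. -/
def dqThetaAt (x : Param) (τ : ℂ) : ℂ := dqTheta (rep x.1) (rep x.2) τ

/-- The order of the zero of `∂_q ϑ[p',q']` at `τ` (it is `⊤` if the function vanishes
identically near `τ`). -/
def zeroOrder (x : Param) (τ : UpperHalfPlane) : ℕ∞ :=
  analyticOrderAt (dqThetaAt x) (τ : ℂ)

/-- `R` contains exactly one point of each orbit of the modular group on the upper half-plane. -/
def IsFundamentalSet (R : Set UpperHalfPlane) : Prop :=
  ∀ τ : UpperHalfPlane, ∃! P : UpperHalfPlane, P ∈ R ∧ P ∈ MulAction.orbit SL(2, ℤ) τ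

/-- The points of `R` equivalent neither to `i` nor to `ρ = exp (2 π i / 3)`. -/
def nonElliptic (R : Set UpperHalfPlane) : Set UpperHalfPlane :=
  {P | P ∈ R ∧ P ∉ MulAction.orbit SL(2, ℤ) UpperHalfPlane.I ∧
    P ∉ MulAction.orbit SL(2, ℤ) UpperHalfPlane.ρ}

end BianchiIX

end

section WeierstrassUniqueness

open Filter Topology

theorem AnalyticAt.eventually_eq_zero_of_euler_equation {d A B : ℂ → ℂ}
    (hd : AnalyticAt ℂ d 0) (hA : ContinuousAt A 0) (hB : ContinuousAt B 0)
    (hAB : ∀ m : ℕ, (m : ℂ) * A 0 ≠ B 0)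
    (h : ∀ᶠ z in 𝓝[≠] (0 : ℂ), z * deriv d z * A z = d z * B z) :
    ∀ᶠ z in 𝓝 (0 : ℂ), d z = 0 := by
  by_contra hne
  obtain ⟨n, g, hg, hg0, hdg⟩ := (hd.exists_eventuallyEq_pow_smul_nonzero_iff).mpr hne
  simp only [sub_zero, smul_eq_mul] at hdg
  have hderiv : ∀ᶠ z in 𝓝 (0 : ℂ), deriv d z = n * z ^ (n - 1) * g z + z ^ n * deriv g z := by
    filter_upwards [hdg.eventually_nhds, hg.eventually_analyticAt] with z hz hgz
    rw [EventuallyEq.deriv_eq hz]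
    rw [deriv_fun_mul (by fun_prop) hgz.differentiableAt]
    simp
  have key : ∀ᶠ z in 𝓝[≠] (0 : ℂ), (n * g z + z * deriv g z) * A z = g z * B z := by
    filter_upwards [h, hderiv.filter_mono nhdsWithin_le_nhds, hdg.filter_mono nhdsWithin_le_nhds,
      self_mem_nhdsWithin] with z hz hz' hz'' hz0
    have hz0 : z ≠ 0 := hz0
    have hzn : z ^ n ≠ 0 := pow_ne_zero _ hz0
    apply mul_left_cancel₀ hzn
    rw [hz', hz''] at hz
    rcases n with _ | n
    · simpa [mul_assoc, mul_add] using hz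
    · simp only [Nat.add_sub_cancel] at hz
      rw [pow_succ] at *
      linear_combination hz
  have hc1 : ContinuousAt (fun z ↦ (n * g z + z * deriv g z) * A z) 0 := by
    have := hg.continuousAt
    have := hg.deriv.continuousAt
    fun_prop
  have hc2 : ContinuousAt (fun z ↦ g z * B z) 0 := hg.continuousAt.mul hB
  have := tendsto_nhds_unique ((hc1.tendsto.mono_left nhdsWithin_le_nhds).congr' key)
    (hc2.tendsto.mono_left nhdsWithin_le_nhds)
  simp only [zero_mul, add_zero] at this
  exact hAB n (mul_left_cancel₀ hg0 (by linear_combination this))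

namespace PeriodPair

open scoped PeriodPair

theorem weierstrassPExcept_zero_eventuallyEq (L M : PeriodPair) (h₂ : L.g₂ = M.g₂)
    (h₃ : L.g₃ = M.g₃) :
    ∀ᶠ z in 𝓝 (0 : ℂ), L.weierstrassPExcept 0 z - M.weierstrassPExcept 0 z = 0 := by
  have hP (L : PeriodPair) (z : ℂ) :
      L.weierstrassP z = L.weierstrassPExcept 0 z + 1 / z ^ 2 := by
    simpa using (L.weierstrassPExcept_add 0 z).symm
  have hP' (L : PeriodPair) (z : ℂ) :
      L.derivWeierstrassP z = L.derivWeierstrassPExcept 0 z - 2 / z ^ 3 := by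
    simpa using (L.derivWeierstrassPExcept_sub 0 z).symm
  have hLa := L.analyticAt_weierstrassPExcept 0
  have hMa := M.analyticAt_weierstrassPExcept 0
  have hLa' := L.analyticAt_derivWeierstrassPExcept 0
  have hMa' := M.analyticAt_derivWeierstrassPExcept 0
  have hLc := hLa.continuousAt
  have hMc := hMa.continuousAt
  have hLc' := hLa'.continuousAt
  have hMc' := hMa'.continuousAt
  refine AnalyticAt.eventually_eq_zero_of_euler_equation
    (A := fun z ↦ z ^ 3 * (L.derivWeierstrassPExcept 0 z + M.derivWeierstrassPExcept 0 z) - 4)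
    (B := fun z ↦ 4 * ((1 + z ^ 2 * L.weierstrassPExcept 0 z) ^ 2 +
      (1 + z ^ 2 * L.weierstrassPExcept 0 z) * (1 + z ^ 2 * M.weierstrassPExcept 0 z) +
      (1 + z ^ 2 * M.weierstrassPExcept 0 z) ^ 2) - L.g₂ * z ^ 4)
    (hLa.sub hMa) (by fun_prop) (by fun_prop) ?_ ?_
  · intro m hm
    norm_num at hm
    have : (m : ℂ) + 3 = 0 := by linear_combination -hm / 4
    norm_cast at this
  · filter_upwards [(L.compl_lattice_sdiff_singleton_mem_nhds 0 |> mem_nhdsWithin_of_mem_nhds),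
      (M.compl_lattice_sdiff_singleton_mem_nhds 0 |> mem_nhdsWithin_of_mem_nhds),
      hLa.eventually_analyticAt.filter_mono nhdsWithin_le_nhds,
      hMa.eventually_analyticAt.filter_mono nhdsWithin_le_nhds,
      self_mem_nhdsWithin] with z hzL hzM haL haM hz0
    have hz0 : z ≠ 0 := hz0
    rw [deriv_fun_sub haL.differentiableAt haM.differentiableAt,
      L.eqOn_deriv_weierstrassPExcept_derivWeierstrassPExcept 0 hzL,
      M.eqOn_deriv_weierstrassPExcept_derivWeierstrassPExcept 0 hzM]
    have hzL' : z ∉ L.lattice := fun h ↦ hzL ⟨h, by simpa using hz0⟩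
    have hzM' : z ∉ M.lattice := fun h ↦ hzM ⟨h, by simpa using hz0⟩
    have e1 := L.derivWeierstrassP_sq z hzL'
    have e2 := M.derivWeierstrassP_sq z hzM'
    rw [hP, hP'] at e1 e2
    rw [← h₂, ← h₃] at e2
    have e : z ^ 6 * ((L.derivWeierstrassPExcept 0 z - 2 / z ^ 3) ^ 2 -
        (M.derivWeierstrassPExcept 0 z - 2 / z ^ 3) ^ 2) =
      z ^ 6 * (4 * (L.weierstrassPExcept 0 z + 1 / z ^ 2) ^ 3 -
        L.g₂ * (L.weierstrassPExcept 0 z + 1 / z ^ 2) -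
        (4 * (M.weierstrassPExcept 0 z + 1 / z ^ 2) ^ 3 -
        L.g₂ * (M.weierstrassPExcept 0 z + 1 / z ^ 2))) := by
      rw [e1, e2]; ring
    field_simp at e
    apply mul_left_cancel₀ (pow_ne_zero 2 hz0)
    linear_combination e

theorem lattice_le_of_invariants_eq (L M : PeriodPair) (h₂ : L.g₂ = M.g₂) (h₃ : L.g₃ = M.g₃) :
    (L.lattice : Set ℂ) ⊆ M.lattice := by
  have hP (L : PeriodPair) (z : ℂ) :
      L.weierstrassP z = L.weierstrassPExcept 0 z + 1 / z ^ 2 := by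
    simpa using (L.weierstrassPExcept_add 0 z).symm
  have hcount (L : PeriodPair) : (L.lattice : Set ℂ).Countable := by
    have : Countable L.lattice := L.latticeEquivProd.toEquiv.countable_iff.mpr inferInstance
    exact Set.to_countable _
  let U : Set ℂ := ((L.lattice : Set ℂ) ∪ M.lattice)ᶜ
  have hconn : IsConnected U :=
    Set.Countable.isConnected_compl_of_one_lt_rank (by simp) ((hcount L).union (hcount M))
  have hdense : Dense U := ((hcount L).union (hcount M)).dense_compl ℝ
  have hopen : IsOpen U := (L.isClosed_lattice.union M.isClosed_lattice).isOpen_compl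
  have hL : AnalyticOnNhd ℂ L.weierstrassP U :=
    L.analyticOnNhd_weierstrassP.mono (Set.compl_subset_compl.mpr Set.subset_union_left)
  have hM : AnalyticOnNhd ℂ M.weierstrassP U :=
    M.analyticOnNhd_weierstrassP.mono (Set.compl_subset_compl.mpr Set.subset_union_right)
  have hnear : ∀ᶠ z in 𝓝 (0 : ℂ), L.weierstrassP z = M.weierstrassP z := by
    filter_upwards [weierstrassPExcept_zero_eventuallyEq L M h₂ h₃] with z hz
    rw [hP L, hP M, sub_eq_zero.mp hz]
  obtain ⟨V, hVsub, hVo, h0V⟩ := eventually_nhds_iff.mp hnear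
  obtain ⟨z₀, hz₀U, hz₀V⟩ := hdense.exists_mem_open hVo ⟨0, h0V⟩
  have heq : Set.EqOn L.weierstrassP M.weierstrassP U :=
    hL.eqOn_of_preconnected_of_eventuallyEq hM hconn.isPreconnected hz₀U
      (by filter_upwards [hVo.mem_nhds hz₀V] with z hz using hVsub z hz)
  intro l hl
  by_contra hlM
  have hlM' : l ∉ M.lattice := hlM
  have hev : L.weierstrassP =ᶠ[𝓝[≠] l] M.weierstrassP := by
    filter_upwards [mem_nhdsWithin_of_mem_nhds (L.compl_lattice_sdiff_singleton_mem_nhds l),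
      mem_nhdsWithin_of_mem_nhds (M.isClosed_lattice.isOpen_compl.mem_nhds hlM),
      self_mem_nhdsWithin] with z hz hzM hzl
    refine heq fun h ↦ h.elim (fun h ↦ hz ⟨h, hzl⟩) hzM
  have ho := meromorphicOrderAt_congr hev
  rw [L.order_weierstrassP l hl] at ho
  have := (M.analyticOnNhd_weierstrassP l hlM).meromorphicOrderAt_nonneg
  rw [← ho] at this
  exact absurd this (by decide)

theorem lattice_eq_of_invariants_eq (L M : PeriodPair) (h₂ : L.g₂ = M.g₂) (h₃ : L.g₃ = M.g₃) :
    (L.lattice : Set ℂ) = M.lattice :=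
  (lattice_le_of_invariants_eq L M h₂ h₃).antisymm
    (lattice_le_of_invariants_eq M L h₂.symm h₃.symm)

end PeriodPair

end WeierstrassUniqueness

section JInvariant

open Filter Topology UpperHalfPlane ModularForm EisensteinSeries
open scoped MatrixGroups

/-- The pair of periods `(μ z, μ)` attached to a point of the upper half-plane. -/
noncomputable def UpperHalfPlane.periodPair (z : ℍ) (μ : ℂ) (hμ : μ ≠ 0) : PeriodPair where
  ω₁ := μ * z
  ω₂ := μ
  indep := by
    rw [LinearIndependent.pair_iff]
    intro s t h
    have h' : (s : ℂ) * z + t = 0 := by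
      apply mul_left_cancel₀ hμ
      simp only [Complex.real_smul] at h
      linear_combination h
    have hs : s = 0 := by simpa [z.im_ne_zero] using congrArg Complex.im h'
    subst hs
    simpa using h'

namespace UpperHalfPlane

theorem periodPair_G (z : ℍ) (μ : ℂ) (hμ : μ ≠ 0) {k : ℕ} (hk : 3 ≤ k) :
    (z.periodPair μ hμ).G k = (μ ^ k)⁻¹ * (2 * riemannZeta k * ModularForm.E hk z) := by
  have hE : ModularForm.E hk z = (1 / 2 : ℂ) * eisensteinSeries (N := 1) 0 k z := rfl
  have h := tsum_eisSummand_eq_riemannZeta_mul_eisensteinSeries hk z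
  rw [hE, show 2 * riemannZeta k * ((1 / 2 : ℂ) * eisensteinSeries (N := 1) 0 k z) =
    riemannZeta k * eisensteinSeries (N := 1) 0 k z by ring, ← h, ← tsum_mul_left,
    PeriodPair.G, ← (z.periodPair μ hμ).latticeEquivProd.symm.toEquiv.tsum_eq,
    ← (finTwoArrowEquiv ℤ).tsum_eq]
  refine tsum_congr fun v ↦ ?_
  have := (z.periodPair μ hμ).latticeEquiv_symm_apply (v 0, v 1)
  change (((z.periodPair μ hμ).latticeEquivProd.symm (v 0, v 1) : ℂ) ^ k)⁻¹ = _
  rw [this, eisSummand, zpow_neg, ← mul_inv, zpow_natCast, ← mul_pow]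
  simp only [periodPair]
  ring_nf

theorem exists_smul_eq_of_lattice_eq {z w : ℍ} {μ : ℂ} (hμ : μ ≠ 0)
    (h : ((z.periodPair 1 one_ne_zero).lattice : Set ℂ) = (w.periodPair μ hμ).lattice) :
    ∃ γ : SL(2, ℤ), γ • w = z := by
  have mem (x : ℂ) : (∃ m n : ℤ, (m : ℂ) * z + n = x) ↔
      ∃ m n : ℤ, (m : ℂ) * (μ * w) + n * μ = x := by
    have := Set.ext_iff.mp h x
    simp only [SetLike.mem_coe, PeriodPair.mem_lattice, periodPair, one_mul, mul_one] at this
    exact this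
  obtain ⟨a, b, hab⟩ := (mem z).mp ⟨1, 0, by simp⟩
  obtain ⟨c, d, hcd⟩ := (mem 1).mp ⟨0, 1, by simp⟩
  obtain ⟨a', b', hab'⟩ := (mem (μ * w)).mpr ⟨1, 0, by simp⟩
  obtain ⟨c', d', hcd'⟩ := (mem μ).mpr ⟨0, 1, by simp⟩
  have hz (m n m' n' : ℤ) (hm : (m : ℂ) * z + n = m' * z + n') : m = m' ∧ n = n' := by
    have h1 := congrArg Complex.im hm
    have h2 := congrArg Complex.re hm
    simp [z.im_ne_zero] at h1
    subst h1
    simpa using h2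
  have e1 := hz (a * a' + b * c') (a * b' + b * d') 1 0 (by
    push_cast; rw [← hab', ← hcd'] at hab; linear_combination hab)
  have e2 := hz (c * a' + d * c') (c * b' + d * d') 0 1 (by
    push_cast; rw [← hab', ← hcd'] at hcd; linear_combination hcd)
  have hdet : (a * d - b * c) * (a' * d' - b' * c') = 1 := by
    linear_combination (c * b' + d * d') * e1.1 + e2.2 - (c * a' + d * c') * e1.2
  have hden : (c : ℂ) * w + d ≠ 0 := by
    intro h0
    have : μ * ((c : ℂ) * w + d) = 1 := by linear_combination hcd
    simp [h0] at this
  have hzw : (z : ℂ) = (a * w + b) / (c * w + d) := by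
    rw [eq_div_iff hden]
    have : μ * ((z : ℂ) * (c * w + d)) = μ * (a * w + b) := by
      linear_combination (z : ℂ) * hcd - hab
    exact mul_left_cancel₀ hμ this
  have him : z.im * Complex.normSq (c * w + d) = (a * d - b * c : ℤ) * w.im := by
    have h1 : (z : ℂ) * (c * w + d) = a * w + b := by
      rw [hzw, div_mul_cancel₀ _ hden]
    have h2 := congrArg Complex.im h1
    have h3 := congrArg Complex.re h1
    simp [Complex.mul_im, Complex.mul_re] at h2 h3
    rw [Complex.normSq_apply]
    simp
    linear_combination (c * w.re + d) * h2 - c * w.im * h3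
  have hpos : 0 < a * d - b * c := by
    have : 0 < ((a * d - b * c : ℤ) : ℝ) * w.im := by
      rw [← him]
      exact mul_pos z.im_pos (Complex.normSq_pos.mpr hden)
    exact_mod_cast (pos_iff_pos_of_mul_pos this).mpr w.im_pos
  have hone : a * d - b * c = 1 := by
    rcases Int.isUnit_iff.mp (IsUnit.of_mul_eq_one _ hdet) with h | h <;> omega
  obtain ⟨γ, h00, h01, h10, h11⟩ : ∃ γ : SL(2, ℤ), γ 0 0 = a ∧ γ 0 1 = b ∧ γ 1 0 = c ∧ γ 1 1 = d :=
    ⟨⟨!![a, b; c, d], by simpa [Matrix.det_fin_two] using hone⟩, rfl, rfl, rfl, rfl⟩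
  refine ⟨γ, ?_⟩
  ext1
  rw [specialLinearGroup_apply, hzw]
  simp [h00, h01, h10, h11]

/-- The `j`-invariant, normalised as `E₄³ / Δ`. -/
noncomputable def jInv (z : ℍ) : ℂ := E₄ z ^ 3 / discriminant z

theorem _root_.ModularForm.levelOne_smul {k : ℤ} (f : ModularForm 𝒮ℒ k) (γ : SL(2, ℤ)) (z : ℍ) :
    f (γ • z) = denom γ z ^ k * f z :=
  SlashInvariantForm.slash_action_eqn'' f (MonoidHom.mem_range.mpr ⟨γ, rfl⟩) z

theorem _root_.ModularForm.discriminant_smul (γ : SL(2, ℤ)) (z : ℍ) :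
    discriminant (γ • z) = denom γ z ^ (12 : ℤ) * discriminant z :=
  SlashInvariantForm.slash_action_eqn'' CuspForm.discriminant (MonoidHom.mem_range.mpr ⟨γ, rfl⟩) z

theorem jInv_smul (γ : SL(2, ℤ)) (z : ℍ) : jInv (γ • z) = jInv z := by
  have h := denom_ne_zero γ z
  rw [jInv, jInv, levelOne_smul, discriminant_smul, mul_pow, ← zpow_natCast, ← zpow_mul]
  exact mul_div_mul_left _ _ (zpow_ne_zero _ h)

theorem exists_smul_eq_of_jInv_eq {z w : ℍ} (h : jInv z = jInv w) :
    ∃ γ : SL(2, ℤ), γ • w = z := by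
  have hz := discriminant_ne_zero z
  have hw := discriminant_ne_zero w
  have hz' := discriminant_eq_E₄_cube_sub_E₆_sq z
  have hw' := discriminant_eq_E₄_cube_sub_E₆_sq w
  obtain ⟨l, hl⟩ := IsAlgClosed.exists_pow_nat_eq (discriminant z / discriminant w)
    (n := 12) (by norm_num)
  rw [eq_div_iff hw] at hl
  rw [jInv, jInv, div_eq_div_iff hz hw] at h
  have h4 : E₄ z ^ 3 = (l ^ 4 * E₄ w) ^ 3 := by
    apply mul_right_cancel₀ hw
    rw [h, ← hl]; ring
  have h6 : E₆ z ^ 2 = (l ^ 6 * E₆ w) ^ 2 := by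
    linear_combination h4 + 1728 * hz' - 1728 * l ^ 12 * hw' + 1728 * hl
  obtain ⟨ω, hω, h4'⟩ : ∃ ω : ℂ, ω ^ 3 = 1 ∧ E₄ z = ω * (l ^ 4 * E₄ w) := by
    by_cases h0 : l ^ 4 * E₄ w = 0
    · refine ⟨1, by simp, ?_⟩
      rw [h0] at h4 ⊢
      simpa using h4
    · refine ⟨E₄ z / (l ^ 4 * E₄ w), ?_, (div_mul_cancel₀ _ h0).symm⟩
      rw [div_pow, h4, div_self (pow_ne_zero _ h0)]
  obtain ⟨s, hs, h6'⟩ : ∃ s : ℂ, s ^ 4 = 1 ∧ E₆ z = s ^ 6 * (l ^ 6 * E₆ w) := by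
    rcases sq_eq_sq_iff_eq_or_eq_neg.mp h6 with h | h
    · exact ⟨1, by simp, by simpa using h⟩
    · refine ⟨Complex.I, Complex.I_pow_four, ?_⟩
      rw [h, show Complex.I ^ 6 = -1 by
        rw [show (6 : ℕ) = 4 + 2 by norm_num, pow_add, Complex.I_pow_four, Complex.I_sq, one_mul],
        neg_one_mul]
  have hl0 : l ≠ 0 := by rintro rfl; simp at hl; exact hz hl.symm
  have hω0 : ω ≠ 0 := by rintro rfl; simp at hω
  have hs0 : s ≠ 0 := by rintro rfl; simp at hs
  have hμ : (l * ω * s)⁻¹ ≠ 0 := inv_ne_zero (by simp [hl0, hω0, hs0])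
  refine exists_smul_eq_of_lattice_eq hμ (PeriodPair.lattice_eq_of_invariants_eq _ _ ?_ ?_)
  · rw [PeriodPair.g₂, PeriodPair.g₂, periodPair_G _ _ _ (by norm_num),
      periodPair_G _ _ _ (by norm_num), h4', inv_pow, inv_inv]
    linear_combination -(60 * 2 * riemannZeta (4 : ℕ) * E₄ w * l ^ 4) *
      (ω * (hω + ω ^ 3 * hs))
  · rw [PeriodPair.g₃, PeriodPair.g₃, periodPair_G _ _ _ (by norm_num),
      periodPair_G _ _ _ (by norm_num), h6', inv_pow, inv_inv]
    linear_combination -(140 * 2 * riemannZeta (6 : ℕ) * E₆ w * l ^ 6) * s ^ 6 * (ω ^ 3 + 1) * hω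

end UpperHalfPlane

end JInvariant

section LevelOne

open Filter Topology UpperHalfPlane ModularForm EisensteinSeries
open scoped MatrixGroups Manifold

namespace ModularForm

/-- A level one modular form built from a function that is bounded at infinity. -/
noncomputable def ofLevelOne {k : ℤ} (f : ℍ → ℂ) (hS : f ∣[k] ModularGroup.S = f)
    (hT : f ∣[k] ModularGroup.T = f) (hf : MDiff f) (hb : IsBoundedAtImInfty f) :
    ModularForm 𝒮ℒ k where
  toFun := f
  slash_action_eq' A hA := by
    obtain ⟨A, rfl⟩ := hA
    exact SlashInvariantForm.slash_action_generators_SL2Z hS hT A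
  holo' := hf
  bdd_at_cusps' {c} hc := by
    rw [Subgroup.IsArithmetic.isCusp_iff_isCusp_SL2Z] at hc
    rw [OnePoint.isBoundedAt_iff_forall_SL2Z hc]
    intro γ _
    rwa [SlashInvariantForm.slash_action_generators_SL2Z hS hT γ]

theorem tendsto_levelOne_atImInfty {k : ℤ} (f : ModularForm 𝒮ℒ k) :
    Tendsto f atImInfty (𝓝 ((qExpansion 1 f).coeff 0)) := by
  have hanal := ModularFormClass.analyticAt_cuspFunction_zero f one_pos one_mem_strictPeriods_SL
  have hper := SlashInvariantFormClass.periodic_comp_ofComplex f one_mem_strictPeriods_SL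
  rw [qExpansion_coeff_zero one_pos hanal hper,
    ← UpperHalfPlane.cuspFunction_apply_zero one_pos hanal hper]
  exact (hanal.continuousAt.tendsto.comp (qParam_tendsto_atImInfty one_pos)).congr
    (fun τ ↦ SlashInvariantFormClass.eq_cuspFunction f τ one_mem_strictPeriods_SL one_ne_zero)

theorem tendsto_E₄_atImInfty : Tendsto E₄ atImInfty (𝓝 1) := by
  have h := tendsto_levelOne_atImInfty E₄
  rwa [E_qExpansion_coeff_zero _ ⟨2, rfl⟩] at h

theorem deriv_comp_ofComplex_bounded {k : ℤ} (f : ModularForm 𝒮ℒ k) :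
    IsBoundedAtImInfty (Derivative.normalizedDerivOfComplex f) := by
  have hanal := ModularFormClass.analyticAt_cuspFunction_zero f one_pos one_mem_strictPeriods_SL
  have hq := qParam_tendsto_atImInfty one_pos
  have hlim : Tendsto (fun z : ℍ ↦ (2 * Real.pi * Complex.I)⁻¹ *
      (deriv (cuspFunction 1 f) (Function.Periodic.qParam 1 z) *
        (2 * Real.pi * Complex.I * Function.Periodic.qParam 1 z))) atImInfty (𝓝 0) := by
    have h1 := hanal.deriv.continuousAt.tendsto.comp hq
    have := (h1.mul (hq.const_mul (2 * Real.pi * Complex.I))).const_mul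
      (2 * Real.pi * Complex.I)⁻¹
    simpa using this
  refine Tendsto.isBigO_one ℝ (hlim.congr fun z ↦ ?_)
  rw [Derivative.normalizedDerivOfComplex]
  congr 1
  have hd : HasDerivAt (Function.Periodic.qParam 1)
      (2 * Real.pi * Complex.I * Function.Periodic.qParam 1 z) (z : ℂ) := by
    have : HasDerivAt (fun w : ℂ ↦ Complex.exp (2 * Real.pi * Complex.I * w / (1 : ℝ)))
        (Complex.exp (2 * Real.pi * Complex.I * z / (1 : ℝ)) *
          (2 * Real.pi * Complex.I * 1 / (1 : ℝ))) (z : ℂ) :=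
      (((hasDerivAt_id (z : ℂ)).const_mul _).div_const _).cexp
    refine this.congr_deriv ?_
    simp [Function.Periodic.qParam, mul_comm]
  have hlt : ‖Function.Periodic.qParam 1 z‖ < 1 :=
    Function.Periodic.norm_qParam_lt_one one_pos z.im_pos
  have hc := (ModularFormClass.differentiableAt_cuspFunction f one_pos one_mem_strictPeriods_SL
    hlt).hasDerivAt.comp (z : ℂ) hd
  have hev : (f ∘ ofComplex) =ᶠ[𝓝 (z : ℂ)]
      (cuspFunction 1 f ∘ Function.Periodic.qParam 1) := by
    filter_upwards [isOpen_upperHalfPlaneSet.mem_nhds z.im_pos] with w hw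
    have := SlashInvariantFormClass.eq_cuspFunction f ⟨w, hw⟩ one_mem_strictPeriods_SL one_ne_zero
    simpa [ofComplex_apply_of_im_pos hw] using this.symm
  rw [hev.deriv_eq, hc.deriv]

theorem exists_serreDerivative_E₄_eq :
    ∃ c : ℂ, ∀ z, Derivative.serreDerivative 4 E₄ z = c * E₆ z := by
  have hMD : MDiff E₄ := E₄.holo'
  have hinv (γ : SL(2, ℤ)) : Derivative.serreDerivative 4 E₄ ∣[(6 : ℤ)] γ =
      Derivative.serreDerivative 4 E₄ := by
    have := Derivative.serreDerivative_slash_invariant (k := 4) (γ := γ) hMD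
      (E₄.slash_action_eq' _ ⟨γ, rfl⟩)
    exact_mod_cast this
  have hb : IsBoundedAtImInfty (Derivative.serreDerivative 4 E₄) := by
    have h1 := deriv_comp_ofComplex_bounded E₄
    have h2 : IsBoundedAtImInfty E₄ := tendsto_E₄_atImInfty.isBigO_one ℝ
    have h3 := (isBoundedAtImInfty_E2.mul h2).const_mul_left (4 * 12⁻¹ : ℂ)
    have h4 : (fun z ↦ (4 * 12⁻¹ : ℂ) * (EisensteinSeries.E2 z * E₄ z)) =O[atImInfty]
        (1 : ℍ → ℝ) := by simpa using! h3
    refine (Asymptotics.IsBigO.sub (show _ =O[atImInfty] (1 : ℍ → ℝ) from h1) h4).congr_left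
      fun z ↦ ?_
    simp only [Derivative.serreDerivative_apply, mul_assoc]
  let f : ModularForm 𝒮ℒ 6 := ofLevelOne _ (hinv _) (hinv _)
    (Derivative.serreDerivative_mdifferentiable 4 hMD) hb
  obtain ⟨c, hc⟩ : ∃ c : ℂ, c • E₆ = f :=
    (finrank_eq_one_iff_of_nonzero' E₆ (E_ne_zero _ ⟨3, rfl⟩)).mp
      (Module.rank_eq_one_iff_finrank_eq_one.mp levelOne_weight_six_rank_one) _
  exact ⟨c, fun z ↦ (DFunLike.congr_fun hc z).symm⟩

theorem hasDerivAt_discriminant (z : ℍ) : HasDerivAt (discriminant ∘ ofComplex)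
    (2 * Real.pi * Complex.I * E2 z * discriminant z) z := by
  have h1 := (differentiableAt_eta_of_mem_upperHalfPlaneSet z.2).hasDerivAt
  have hl := logDeriv_eta_eq_E2 z
  rw [logDeriv_apply, div_eq_iff (eta_ne_zero z.2)] at hl
  have hev : (discriminant ∘ ofComplex) =ᶠ[𝓝 (z : ℂ)] fun w ↦ eta w ^ 24 := by
    filter_upwards [isOpen_upperHalfPlaneSet.mem_nhds z.im_pos] with w hw
    simp [discriminant, ofComplex_apply_of_im_pos hw]
  refine ((h1.pow 24).congr_of_eventuallyEq hev).congr_deriv ?_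
  rw [hl, discriminant]
  push_cast
  ring

end ModularForm

namespace UpperHalfPlane

theorem exists_hasDerivAt_jInv : ∃ c : ℂ, ∀ z : ℍ, HasDerivAt (jInv ∘ ofComplex)
    (c * (E₄ z ^ 2 * E₆ z / discriminant z)) z := by
  obtain ⟨c, hc⟩ := exists_serreDerivative_E₄_eq
  refine ⟨2 * Real.pi * Complex.I * 3 * c, fun z ↦ ?_⟩
  have h4 : HasDerivAt (E₄ ∘ ofComplex)
      (2 * Real.pi * Complex.I * (c * E₆ z + 4 * 12⁻¹ * E2 z * E₄ z)) z := by
    have hd : DifferentiableAt ℂ (E₄ ∘ ofComplex) z := mdifferentiableAt_iff.mp (E₄.holo' z)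
    refine hd.hasDerivAt.congr_deriv ?_
    rw [← hc, Derivative.serreDerivative_apply, Derivative.normalizedDerivOfComplex]
    have := Complex.two_pi_I_ne_zero
    field_simp
    ring
  have hz := discriminant_ne_zero z
  have := (h4.pow 3).div (hasDerivAt_discriminant z) (by simpa using hz)
  refine this.congr_deriv ?_
  simp only [Function.comp_apply, ofComplex_apply, Pi.pow_apply]
  field_simp
  push_cast
  ring

theorem exists_jInv_eq (r : ℂ) : ∃ z, jInv z = r := by
  by_contra! hne
  have hf0 (z : ℍ) : E₄ z ^ 3 - r * discriminant z ≠ 0 := fun h ↦ hne z <| by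
    rw [jInv, div_eq_iff (discriminant_ne_zero z)]
    linear_combination h
  have hlim : Tendsto (fun z ↦ (E₄ z ^ 3 - r * discriminant z)⁻¹) atImInfty (𝓝 1) := by
    have h1 : Tendsto discriminant atImInfty (𝓝 0) := discriminant_isZeroAtImInfty
    simpa using ((tendsto_E₄_atImInfty.pow 3).sub (h1.const_mul r)).inv₀ (by simp)
  have hinv (γ : SL(2, ℤ)) : (fun z ↦ (E₄ z ^ 3 - r * discriminant z)⁻¹) ∣[(-12 : ℤ)] γ =
      fun z ↦ (E₄ z ^ 3 - r * discriminant z)⁻¹ := by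
    ext z
    have hd := denom_ne_zero γ z
    rw [SL_slash_apply]
    rw [levelOne_smul, discriminant_smul, neg_neg]
    have : (denom γ z ^ (4 : ℤ) * E₄ z) ^ 3 - r * (denom γ z ^ (12 : ℤ) * discriminant z) =
        denom γ z ^ (12 : ℤ) * (E₄ z ^ 3 - r * discriminant z) := by
      rw [mul_pow, ← zpow_natCast _ 3, ← zpow_mul]
      norm_num
      ring
    rw [this, mul_inv, mul_comm, ← mul_assoc, mul_inv_cancel₀ (zpow_ne_zero _ hd), one_mul]
  have hMD : MDiff (fun z ↦ (E₄ z ^ 3 - r * discriminant z)⁻¹) := by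
    have h1 : MDiff (fun z ↦ E₄ z ^ 3 - r * discriminant z) := by
      have := E₄.holo'
      have h2 := CuspForm.discriminant.holo'
      rw [mdifferentiable_iff] at *
      exact (this.pow 3).sub (h2.const_mul r)
    rw [mdifferentiable_iff] at *
    exact h1.inv fun x _ ↦ hf0 _
  let f : ModularForm 𝒮ℒ (-12) := ofLevelOne _ (hinv _) (hinv _) hMD (hlim.isBigO_one ℝ)
  have := congrFun (ModularFormClass.levelOne_neg_weight_eq_zero (by norm_num) f) I
  exact inv_ne_zero (hf0 I) this

end UpperHalfPlane

end LevelOne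

section Ramification

open Filter Topology UpperHalfPlane ModularForm EisensteinSeries
open scoped MatrixGroups Manifold

namespace UpperHalfPlane

theorem E₆_I : E₆ I = 0 := by
  have h := levelOne_smul E₆ ModularGroup.S I
  have hS : ModularGroup.S • I = I := by
    ext1
    rw [modular_S_smul]
    simp
  rw [hS, ModularGroup.denom_S] at h
  have : (I : ℂ) ^ (6 : ℤ) = -1 := by
    rw [zpow_ofNat, coe_I, show (6 : ℕ) = 4 + 2 by norm_num, pow_add, Complex.I_pow_four,
      Complex.I_sq, one_mul]
  rw [this] at h
  linear_combination h / 2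

theorem E₄_ρ : E₄ ρ = 0 := by
  have hρ := ρ_sq
  have hS : ModularGroup.S • ModularGroup.T • ρ = ρ := by
    rw [modular_T_smul, modular_S_smul]
    ext1
    have h1 : (ρ : ℂ) * (1 + ρ) = -1 := by linear_combination hρ
    have : (1 : ℂ) + ρ ≠ 0 := by rintro h; simp [h] at h1
    rw [coe_mk, coe_vadd, Complex.ofReal_one]
    refine (eq_inv_of_mul_eq_one_left ?_).symm
    linear_combination -h1
  have h := levelOne_smul E₄ ModularGroup.S (ModularGroup.T • ρ)
  have hT := levelOne_smul E₄ ModularGroup.T ρ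
  have hd : denom (ModularGroup.T : SL(2, ℤ)) ρ = 1 := by
    rw [ModularGroup.denom_apply]
    simp [ModularGroup.T]
  rw [hS, hT, hd, ModularGroup.denom_S, modular_T_smul, coe_vadd, one_zpow, one_mul,
    Complex.ofReal_one, zpow_ofNat] at h
  have : (2 + (ρ : ℂ)) * E₄ ρ = 0 := by
    linear_combination h + ((ρ : ℂ) ^ 2 + 3 * ρ + 2) * hρ * E₄ ρ
  rcases mul_eq_zero.mp this with h0 | h0
  · have := congrArg Complex.im h0
    simp [ρ.im_ne_zero] at this
  · exact h0

theorem jInv_ρ : jInv ρ = 0 := by simp [jInv, E₄_ρ]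

theorem jInv_sub_eq (z : ℍ) : jInv z - 1728 = E₆ z ^ 2 / discriminant z := by
  have h := discriminant_eq_E₄_cube_sub_E₆_sq z
  rw [jInv, eq_div_iff (discriminant_ne_zero z), sub_mul,
    div_mul_cancel₀ _ (discriminant_ne_zero z)]
  linear_combination -1728 * h

theorem jInv_I : jInv I = 1728 := by
  rw [← sub_eq_zero, jInv_sub_eq, E₆_I]; simp

theorem jInv_eq_iff {z w : ℍ} : jInv z = jInv w ↔ z ∈ MulAction.orbit SL(2, ℤ) w :=
  ⟨exists_smul_eq_of_jInv_eq, by rintro ⟨γ, rfl⟩; exact jInv_smul γ w⟩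

theorem E₄_I_ne_zero : E₄ I ≠ 0 := by
  intro h
  have := jInv_I
  simp [jInv, h] at this

theorem E₆_ρ_ne_zero : E₆ ρ ≠ 0 := by
  intro h
  have := jInv_sub_eq ρ
  simp [jInv_ρ, h] at this

theorem analyticAt_comp_ofComplex {f : ℍ → ℂ} (hf : MDiff f) (z : ℍ) :
    AnalyticAt ℂ (f ∘ ofComplex) z := by
  rw [mdifferentiable_iff] at hf
  exact hf.analyticAt (isOpen_upperHalfPlaneSet.mem_nhds z.im_pos)

theorem mdifferentiable_jInv : MDiff jInv :=
  have h1 := ModularFormClass.holo E₄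
  have h2 := CuspForm.discriminant.holo'
  by
    rw [mdifferentiable_iff] at *
    exact (h1.pow 3).div h2 fun x _ ↦ discriminant_ne_zero _

/-- The ramification index of the `j`-invariant. -/
noncomputable def jRamification (z : ℍ) : ℕ∞ :=
  analyticOrderAt (fun w ↦ jInv (ofComplex w) - jInv z) z

theorem mdifferentiable_discriminant : MDiff discriminant :=
  CuspForm.discriminant.holo'

theorem analyticAt_inv_discriminant (z : ℍ) :
    AnalyticAt ℂ (fun w ↦ (discriminant (ofComplex w))⁻¹) z :=
  (analyticAt_comp_ofComplex mdifferentiable_discriminant z).inv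
    (by simpa using discriminant_ne_zero z)

theorem analyticOrderAt_mul_inv_discriminant {g : ℂ → ℂ} {z : ℍ} (hg : AnalyticAt ℂ g z) :
    analyticOrderAt (g * fun w ↦ (discriminant (ofComplex w))⁻¹) z = analyticOrderAt g z := by
  have h := analyticAt_inv_discriminant z
  have h0 : analyticOrderAt (fun w ↦ (discriminant (ofComplex w))⁻¹) z = 0 := by
    rw [h.analyticOrderAt_eq_zero]
    simpa using discriminant_ne_zero z
  rw [analyticOrderAt_mul hg h, h0, add_zero]

theorem exists_deriv_jInv : ∃ c : ℂ, c ≠ 0 ∧ ∀ z : ℍ,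
    deriv (jInv ∘ ofComplex) z = c * (E₄ z ^ 2 * E₆ z / discriminant z) := by
  obtain ⟨c, hc⟩ := exists_hasDerivAt_jInv
  refine ⟨c, ?_, fun z ↦ (hc z).deriv⟩
  rintro rfl
  have hconst (z : ℍ) : jInv z = jInv I := by
    have := (convex_halfSpace_im_gt 0).is_const_of_fderivWithin_eq_zero (𝕜 := ℂ)
      (f := jInv ∘ ofComplex) (x := z) (y := I)
      (mdifferentiable_iff.mp mdifferentiable_jInv) ?_ z.im_pos I.im_pos
    · simpa only [Function.comp_apply, ofComplex_apply] using this
    · intro w hw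
      rw [fderivWithin_of_isOpen isOpen_upperHalfPlaneSet hw]
      have := hc ⟨w, hw⟩
      rw [zero_mul] at this
      exact this.hasFDerivAt.fderiv.trans (by ext; simp)
  obtain ⟨z, hz⟩ := exists_jInv_eq 0
  rw [hconst z, jInv_I] at hz
  norm_num at hz

theorem exists_jRamification_eq : ∃ e : ℍ → ℕ∞, (∀ z, e z + 1 = jRamification z) ∧
    ∀ z, e z = 2 * analyticOrderAt (E₄ ∘ ofComplex) z + analyticOrderAt (E₆ ∘ ofComplex) z := by
  obtain ⟨c, hc0, hc⟩ := exists_deriv_jInv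
  refine ⟨fun z ↦ analyticOrderAt (deriv (jInv ∘ ofComplex)) z, fun z ↦ ?_, fun z ↦ ?_⟩
  · rw [(analyticAt_comp_ofComplex mdifferentiable_jInv z).analyticOrderAt_deriv_add_one]
    simp [jRamification]
  · have h4 := analyticAt_comp_ofComplex (ModularFormClass.holo E₄) z
    have h6 := analyticAt_comp_ofComplex (ModularFormClass.holo E₆) z
    have hev : deriv (jInv ∘ ofComplex) =ᶠ[𝓝 (z : ℂ)]
        (fun _ ↦ c) * ((E₄ ∘ ofComplex) ^ 2 * (E₆ ∘ ofComplex)) *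
          fun w ↦ (discriminant (ofComplex w))⁻¹ := by
      filter_upwards [isOpen_upperHalfPlaneSet.mem_nhds z.im_pos] with w hw
      have := hc ⟨w, hw⟩
      simp only [Pi.mul_apply, Pi.pow_apply, Function.comp_apply, ofComplex_apply_of_im_pos hw]
      rw [this]
      ring
    have hu0 : analyticOrderAt (fun _ : ℂ ↦ c) (z : ℂ) = 0 := by
      rw [analyticAt_const.analyticOrderAt_eq_zero]
      exact hc0
    have h46 := (h4.pow 2).mul h6
    simp only
    rw [analyticOrderAt_congr hev, analyticOrderAt_mul_inv_discriminant (analyticAt_const.mul h46),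
      analyticOrderAt_mul analyticAt_const h46, hu0, analyticOrderAt_mul (h4.pow 2) h6,
      analyticOrderAt_pow h4, zero_add]
    simp

theorem analyticOrderAt_comp_ofComplex_eq_zero {f : ℍ → ℂ} (hf : MDiff f) {z : ℍ} (hz : f z ≠ 0) :
    analyticOrderAt (f ∘ ofComplex) z = 0 := by
  rw [(analyticAt_comp_ofComplex hf z).analyticOrderAt_eq_zero]
  simpa using hz

theorem jRamification_ne_top (z : ℍ) : jRamification z ≠ ⊤ := by
  rw [jRamification, ne_eq, analyticOrderAt_eq_top]
  intro h
  obtain ⟨w, hw⟩ := exists_jInv_eq (jInv z + 1)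
  have hMD : MDiff (fun w ↦ jInv w - jInv z) := by
    have := mdifferentiable_jInv
    rw [mdifferentiable_iff] at *
    exact this.sub_const _
  have h0 : (fun w ↦ jInv w - jInv z) = 0 := by
    refine eq_zero_of_frequently hMD (τ := z) ?_
    have : ∀ᶠ x : ℍ in 𝓝 z, jInv x - jInv z = 0 := by
      have := (continuous_coe.tendsto z).eventually h
      simpa using this
    exact (this.filter_mono nhdsWithin_le_nhds).frequently
  have := congrFun h0 w
  simp [hw] at this

theorem jRamification_I : jRamification I = 2 := by
  obtain ⟨e, he, he'⟩ := exists_jRamification_eq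
  have h1 := he I
  have ht := jRamification_ne_top I
  rw [he', analyticOrderAt_comp_ofComplex_eq_zero (ModularFormClass.holo E₄) E₄_I_ne_zero] at h1
  have h6 := analyticAt_comp_ofComplex (ModularFormClass.holo E₆) I
  have h2 : jRamification I = 2 * analyticOrderAt (E₆ ∘ ofComplex) I := by
    have hev : (fun w ↦ jInv (ofComplex w) - jInv I) =
        (E₆ ∘ ofComplex) ^ 2 * fun w ↦ (discriminant (ofComplex w))⁻¹ := by
      ext w
      rw [jInv_I, jInv_sub_eq]
      rfl
    rw [jRamification, hev, analyticOrderAt_mul_inv_discriminant (h6.pow 2),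
      analyticOrderAt_pow h6]
    simp
  rw [h2] at h1 ht ⊢
  generalize analyticOrderAt (E₆ ∘ ofComplex) I = a at *
  induction a using ENat.recTopCoe with
  | top => simp at ht
  | coe a =>
    norm_cast at h1 ⊢
    omega

theorem jRamification_ρ : jRamification ρ = 3 := by
  obtain ⟨e, he, he'⟩ := exists_jRamification_eq
  have h1 := he ρ
  have ht := jRamification_ne_top ρ
  rw [he', analyticOrderAt_comp_ofComplex_eq_zero (ModularFormClass.holo E₆) E₆_ρ_ne_zero] at h1
  have h4 := analyticAt_comp_ofComplex (ModularFormClass.holo E₄) ρ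
  have h2 : jRamification ρ = 3 * analyticOrderAt (E₄ ∘ ofComplex) ρ := by
    have hev : (fun w ↦ jInv (ofComplex w) - jInv ρ) =
        (E₄ ∘ ofComplex) ^ 3 * fun w ↦ (discriminant (ofComplex w))⁻¹ := by
      ext w
      rw [jInv_ρ, sub_zero]
      rfl
    rw [jRamification, hev, analyticOrderAt_mul_inv_discriminant (h4.pow 3),
      analyticOrderAt_pow h4]
    simp
  rw [h2] at h1 ht ⊢
  generalize analyticOrderAt (E₄ ∘ ofComplex) ρ = a at *
  induction a using ENat.recTopCoe with
  | top => simp at ht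
  | coe a =>
    norm_cast at h1 ⊢
    omega

theorem jRamification_of_notMem_orbit {z : ℍ} (hI : z ∉ MulAction.orbit SL(2, ℤ) I)
    (hρ : z ∉ MulAction.orbit SL(2, ℤ) ρ) : jRamification z = 1 := by
  obtain ⟨e, he, he'⟩ := exists_jRamification_eq
  rw [← he, he', analyticOrderAt_comp_ofComplex_eq_zero (ModularFormClass.holo E₄),
    analyticOrderAt_comp_ofComplex_eq_zero (ModularFormClass.holo E₆)]
  · simp
  · intro h
    refine hI (jInv_eq_iff.mp ?_)
    rw [jInv_I, ← sub_eq_zero, jInv_sub_eq]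
    change E₆ z = 0 at h
    simp [h]
  · intro h
    refine hρ (jInv_eq_iff.mp ?_)
    change E₄ z = 0 at h
    rw [jInv_ρ, jInv, h]
    simp

end UpperHalfPlane

end Ramification

section Valence

open Filter Topology UpperHalfPlane ModularForm EisensteinSeries
open scoped MatrixGroups Manifold

namespace ModularForm

theorem exists_eq_discriminant_pow_mul_eval_jInv (M : ℕ) {k : ℤ} (hk : k = 12 * M)
    (H : ModularForm 𝒮ℒ k) : ∃ Q : Polynomial ℂ, Q.natDegree ≤ M ∧
      Q.coeff M = (qExpansion 1 H).coeff 0 ∧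
      ∀ z, H z = discriminant z ^ M * Q.eval (jInv z) := by
  induction M generalizing k with
  | zero =>
    obtain rfl : k = 0 := by simpa using hk
    obtain ⟨c, hc⟩ := ModularFormClass.levelOne_weight_zero_const H
    refine ⟨Polynomial.C c, by simp, ?_, fun z ↦ by simp [hc]⟩
    have h := tendsto_levelOne_atImInfty H
    rw [hc] at h
    simpa [hc] using tendsto_nhds_unique tendsto_const_nhds h
  | succ M ih =>
    set a := (qExpansion 1 H).coeff 0 with ha
    let E : ModularForm 𝒮ℒ k :=
      (E₄.pow (3 * (M + 1))).mcast (by rw [hk]; push_cast; ring)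
    have hEapp (z : ℍ) : E z = E₄ z ^ (3 * (M + 1)) := by
      simp only [E, coe_mcast, coe_pow, Pi.pow_apply]
    have hE : Tendsto E atImInfty (𝓝 1) := by
      simpa using (tendsto_E₄_atImInfty.pow (3 * (M + 1))).congr fun z ↦ (hEapp z).symm
    have hsub : Tendsto (H - a • E : ModularForm 𝒮ℒ k) atImInfty (𝓝 0) := by
      have := (tendsto_levelOne_atImInfty H).sub (hE.const_mul a)
      rwa [mul_one, ← ha, sub_self] at this
    have h0 : (qExpansion 1 (H - a • E : ModularForm 𝒮ℒ k)).coeff 0 = 0 :=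
      tendsto_nhds_unique (tendsto_levelOne_atImInfty _) hsub
    obtain ⟨Q, hdeg, -, hQ⟩ := ih (k := k - 12) (by rw [hk]; push_cast; ring)
      (CuspForm.discriminantEquiv (toCuspForm _ h0))
    refine ⟨Q + Polynomial.C a * Polynomial.X ^ (M + 1), ?_, ?_, fun z ↦ ?_⟩
    · refine (Polynomial.natDegree_add_le _ _).trans (max_le (by omega) ?_)
      exact Polynomial.natDegree_C_mul_X_pow_le _ _
    · simp [Polynomial.coeff_eq_zero_of_natDegree_lt (Nat.lt_succ_of_le hdeg)]
    · have h1 := hQ z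
      have hz := discriminant_ne_zero z
      rw [CuspForm.discriminantEquiv_apply, toCuspForm_apply, div_eq_iff hz] at h1
      simp only [sub_apply, smul_apply, smul_eq_mul, hEapp] at h1
      simp only [Polynomial.eval_add, Polynomial.eval_mul, Polynomial.eval_C,
        Polynomial.eval_pow, Polynomial.eval_X]
      have h2 : discriminant z ^ (M + 1) * jInv z ^ (M + 1) = E₄ z ^ (3 * (M + 1)) := by
        rw [← mul_pow, jInv, mul_div_cancel₀ _ hz, pow_mul]
      linear_combination h1 - a * h2

end ModularForm

namespace UpperHalfPlane

theorem analyticOrderAt_eval_jInv (Q : Polynomial ℂ) (hQ : Q ≠ 0) (M : ℕ) {f : ℂ → ℂ}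
    (hf : ∀ z : ℍ, f z = discriminant z ^ M * Q.eval (jInv z)) (z : ℍ) :
    analyticOrderAt f z = Q.rootMultiplicity (jInv z) * jRamification z := by
  obtain ⟨Q₁, hQ₁, hdvd⟩ := Q.exists_eq_pow_rootMultiplicity_mul_and_not_dvd hQ (jInv z)
  rw [Polynomial.dvd_iff_isRoot] at hdvd
  set m := Q.rootMultiplicity (jInv z)
  have hj := analyticAt_comp_ofComplex mdifferentiable_jInv z
  have hjs : AnalyticAt ℂ (fun w ↦ jInv (ofComplex w) - jInv z) z := hj.sub analyticAt_const
  have hD := analyticAt_comp_ofComplex mdifferentiable_discriminant z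
  have hu : AnalyticAt ℂ (fun w ↦ discriminant (ofComplex w) ^ M * Q₁.eval (jInv (ofComplex w)))
      z :=
    (hD.pow M).mul ((AnalyticOnNhd.eval_polynomial Q₁ (jInv z) trivial).fun_comp_of_eq hj (by simp))
  have hev : f =ᶠ[𝓝 (z : ℂ)] (fun w ↦ jInv (ofComplex w) - jInv z) ^ m *
      fun w ↦ discriminant (ofComplex w) ^ M * Q₁.eval (jInv (ofComplex w)) := by
    filter_upwards [isOpen_upperHalfPlaneSet.mem_nhds z.im_pos] with w hw
    have := hf ⟨w, hw⟩
    simp only [Pi.mul_apply, Pi.pow_apply, ofComplex_apply_of_im_pos hw]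
    refine this.trans ?_
    conv_lhs => rw [hQ₁]
    simp only [Polynomial.eval_mul, Polynomial.eval_pow, Polynomial.eval_sub, Polynomial.eval_X,
      Polynomial.eval_C]
    ring
  have hu0 : analyticOrderAt (fun w ↦ discriminant (ofComplex w) ^ M *
      Q₁.eval (jInv (ofComplex w))) z = 0 := by
    rw [hu.analyticOrderAt_eq_zero]
    simpa [discriminant_ne_zero] using hdvd
  rw [analyticOrderAt_congr hev, analyticOrderAt_mul (hjs.pow m) hu, hu0, add_zero,
    analyticOrderAt_pow hjs, jRamification, nsmul_eq_mul]

/-- The weighted count of zeros over a fundamental set. -/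
theorem valence_formula_eval_jInv (Q : Polynomial ℂ) (hQ : Q ≠ 0) (M : ℕ) {f : ℂ → ℂ}
    (hf : ∀ z : ℍ, f z = discriminant z ^ M * Q.eval (jInv z)) {R : Set ℍ}
    (hR : BianchiIX.IsFundamentalSet R) :
    {P | P ∈ R ∧ analyticOrderAt f P ≠ 0}.Finite ∧
    (1 / 2 : ℚ) * ((analyticOrderAt f I).toNat : ℚ) +
      (1 / 3 : ℚ) * ((analyticOrderAt f ρ).toNat : ℚ) +
      ∑ᶠ P ∈ BianchiIX.nonElliptic R, ((analyticOrderAt f (P : ℂ)).toNat : ℚ) =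
    Q.natDegree := by
  have hord := analyticOrderAt_eval_jInv Q hQ M hf
  have hinj : Set.InjOn jInv R := by
    intro P hP P' hP' h
    obtain ⟨_, -, huniq⟩ := hR P
    exact (huniq P ⟨hP, MulAction.mem_orbit_self P⟩).trans
      (huniq P' ⟨hP', jInv_eq_iff.mp h.symm⟩).symm
  constructor
  · refine Set.Finite.of_finite_image ((Q.roots.toFinset.finite_toSet).subset ?_)
      (hinj.mono fun P hP ↦ hP.1)
    rintro _ ⟨P, ⟨-, hP⟩, rfl⟩
    rw [hord] at hP
    have : Q.rootMultiplicity (jInv P) ≠ 0 := by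
      intro h; simp [h] at hP
    simpa [hQ] using (Polynomial.rootMultiplicity_pos hQ).mp (Nat.pos_of_ne_zero this)
  · have hinj' : Set.InjOn jInv (BianchiIX.nonElliptic R) := hinj.mono fun P hP ↦ hP.1
    have himage : jInv '' BianchiIX.nonElliptic R = ({1728, 0} : Set ℂ)ᶜ := by
      ext c
      simp only [Set.mem_image, Set.mem_compl_iff, Set.mem_insert_iff, Set.mem_singleton_iff]
      constructor
      · rintro ⟨P, ⟨-, h1, h2⟩, rfl⟩
        rw [← jInv_eq_iff, jInv_I] at h1
        rw [← jInv_eq_iff, jInv_ρ] at h2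
        tauto
      · intro hc
        obtain ⟨z, rfl⟩ := exists_jInv_eq c
        obtain ⟨P, ⟨hP, hPz⟩, -⟩ := hR z
        have hj := jInv_eq_iff.mpr hPz
        refine ⟨P, ⟨hP, ?_, ?_⟩, hj⟩
        · rw [← jInv_eq_iff, jInv_I, hj]; tauto
        · rw [← jInv_eq_iff, jInv_ρ, hj]; tauto
    have hsum : ∑ᶠ P ∈ BianchiIX.nonElliptic R, ((analyticOrderAt f (P : ℂ)).toNat : ℚ) =
        ∑ᶠ c ∈ ({1728, 0} : Set ℂ)ᶜ, (Q.rootMultiplicity c : ℚ) := by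
      rw [← himage, finsum_mem_image hinj']
      refine finsum_mem_congr rfl fun P hP ↦ ?_
      rw [hord, jRamification_of_notMem_orbit hP.2.1 hP.2.2]
      simp
    have hsupp : (Function.support fun c : ℂ ↦ (Q.rootMultiplicity c : ℚ)) ⊆
        Q.roots.toFinset := by
      intro c hc
      have : Q.rootMultiplicity c ≠ 0 := by simpa using hc
      simpa [hQ] using (Polynomial.rootMultiplicity_pos hQ).mp (Nat.pos_of_ne_zero this)
    have hfin : (Function.support fun c : ℂ ↦ (Q.rootMultiplicity c : ℚ)).Finite :=
      (Finset.finite_toSet _).subset hsupp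
    have htot : ∑ᶠ c : ℂ, (Q.rootMultiplicity c : ℚ) = Q.natDegree := by
      rw [finsum_eq_sum_of_support_subset _ hsupp, ← Nat.cast_sum]
      simp only [← Polynomial.count_roots]
      rw [Multiset.toFinset_sum_count_eq, IsAlgClosed.card_roots_eq_natDegree]
    rw [hsum, hord, hord, jRamification_I, jRamification_ρ, jInv_I, jInv_ρ, ← htot]
    have hsplit := finsum_mem_add_sdiff' (f := fun c : ℂ ↦ (Q.rootMultiplicity c : ℚ))
      (s := {1728, 0}) (t := Set.univ) (Set.subset_univ _) (by simpa using hfin)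
    rw [finsum_mem_univ, finsum_mem_pair (by norm_num), ← Set.compl_eq_univ_sdiff] at hsplit
    rw [← hsplit]
    have e2 (a : ℕ) : (((a : ℕ∞) * 2).toNat : ℚ) = a * 2 := by
      have : ((a : ℕ∞) * 2) = ((a * 2 : ℕ) : ℕ∞) := by push_cast; rfl
      rw [this, ENat.toNat_natCast]; push_cast; rfl
    have e3 (a : ℕ) : (((a : ℕ∞) * 3).toNat : ℚ) = a * 3 := by
      have : ((a : ℕ∞) * 3) = ((a * 3 : ℕ) : ℕ∞) := by push_cast; rfl
      rw [this, ENat.toNat_natCast]; push_cast; rfl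
    rw [e2, e3]
    ring

end UpperHalfPlane

end Valence

section Orbits

namespace BianchiIX

theorem half_add_half : half + half = 0 := by
  rw [half, ← AddCircle.coe_add]
  norm_num

theorem neg_half : -half = half := neg_eq_of_add_eq_zero_left half_add_half

/-- The representative in `(-1/2, 1/2]` of a class modulo 1. -/
noncomputable def centeredRep (a : UnitAddCircle) : ℝ := (AddCircle.equivIoc (1 : ℝ) (-1 / 2) a : ℝ)

theorem coe_centeredRep (a : UnitAddCircle) : (centeredRep a : UnitAddCircle) = a :=
  (AddCircle.equivIoc (1 : ℝ) (-1 / 2)).symm_apply_apply a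

theorem centeredRep_mem (a : UnitAddCircle) : -1 / 2 < centeredRep a ∧ centeredRep a ≤ 1 / 2 := by
  have := (AddCircle.equivIoc (1 : ℝ) (-1 / 2) a).2
  rw [Set.mem_Ioc] at this
  exact ⟨this.1, this.2.trans (by norm_num)⟩

theorem coe_eq_coe_iff_exists {s t : ℝ} :
    (s : UnitAddCircle) = t ↔ ∃ k : ℤ, s = t + k := by
  rw [← sub_eq_zero, ← AddCircle.coe_sub, AddCircle.coe_eq_zero_iff]
  refine exists_congr fun k ↦ ?_
  rw [zsmul_eq_mul, mul_one]
  constructor <;> intro h <;> linarith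

theorem centeredRep_eq {a : UnitAddCircle} {t : ℝ} (ht : (t : UnitAddCircle) = a)
    (h1 : -1 / 2 < t) (h2 : t ≤ 1 / 2) : centeredRep a = t := by
  have h3 := centeredRep_mem a
  obtain ⟨k, hk⟩ := coe_eq_coe_iff_exists.mp ((coe_centeredRep a).trans ht.symm)
  have hk1 : (-1 : ℝ) < k := by linarith
  have hk2 : (k : ℝ) < 1 := by linarith
  have : k = 0 := by
    have : -1 < k := by exact_mod_cast hk1
    have : k < 1 := by exact_mod_cast hk2
    omega
  simpa [this] using hk

theorem centeredRep_half : centeredRep half = 1 / 2 :=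
  centeredRep_eq rfl (by norm_num) le_rfl

theorem centeredRep_zero : centeredRep 0 = 0 :=
  centeredRep_eq (by simp) (by norm_num) (by norm_num)

theorem centeredRep_eq_half_iff {a : UnitAddCircle} : centeredRep a = 1 / 2 ↔ a = half := by
  refine ⟨fun h ↦ ?_, fun h ↦ h ▸ centeredRep_half⟩
  rw [← coe_centeredRep a, h]
  rfl

theorem centeredRep_eq_zero_iff {a : UnitAddCircle} : centeredRep a = 0 ↔ a = 0 := by
  refine ⟨fun h ↦ ?_, fun h ↦ h ▸ centeredRep_zero⟩
  rw [← coe_centeredRep a, h]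
  simp

theorem centeredRep_lt_half {a : UnitAddCircle} (ha : a ≠ half) : centeredRep a < 1 / 2 :=
  lt_of_le_of_ne (centeredRep_mem a).2 fun h ↦ ha (centeredRep_eq_half_iff.mp h)

theorem centeredRep_neg {a : UnitAddCircle} (ha : a ≠ half) :
    centeredRep (-a) = -centeredRep a := by
  have h := centeredRep_lt_half ha
  have h' := centeredRep_mem a
  refine centeredRep_eq ?_ (by linarith) (by linarith)
  rw [AddCircle.coe_neg, coe_centeredRep]

theorem centeredRep_neg_sq (a : UnitAddCircle) : centeredRep (-a) ^ 2 = centeredRep a ^ 2 := by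
  by_cases ha : a = half
  · rw [ha, neg_half]
  · rw [centeredRep_neg ha, neg_sq]

theorem eq_zero_or_half_of_neg_eq {a : UnitAddCircle} (h : -a = a) : a = 0 ∨ a = half := by
  by_cases ha : a = half
  · exact Or.inr ha
  · left
    have := centeredRep_neg ha
    rw [h] at this
    exact centeredRep_eq_zero_iff.mp (by linarith)

/-- The odd sawtooth function: the representative in `(-1/2, 1/2)`, and `0` at `1/2`. -/
noncomputable def sawtooth (a : UnitAddCircle) : ℝ :=
  open Classical in if a = half then 0 else centeredRep a

theorem sawtooth_neg (a : UnitAddCircle) : sawtooth (-a) = -sawtooth a := by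
  by_cases ha : a = half
  · simp [sawtooth, ha, neg_half]
  · have : -a ≠ half := fun h ↦ ha (by rw [← neg_neg a, h, neg_half])
    simp [sawtooth, ha, this, centeredRep_neg ha]

theorem sawtooth_identity {a b c : UnitAddCircle} (h : a + b + c = half)
    (hne : ¬(a = half ∧ b = half)) :
    centeredRep a ^ 2 + centeredRep b ^ 2 + centeredRep c ^ 2 +
      2 * (sawtooth a * sawtooth b + sawtooth b * sawtooth c + sawtooth c * sawtooth a) =
      1 / 4 := by
  have hk : ∃ k : ℤ, centeredRep a + centeredRep b + centeredRep c = 1 / 2 + k := by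
    refine coe_eq_coe_iff_exists.mp ?_
    rw [AddCircle.coe_add, AddCircle.coe_add, coe_centeredRep, coe_centeredRep, coe_centeredRep, h]
    rfl
  obtain ⟨k, hk⟩ := hk
  have ha' := centeredRep_mem a
  have hb' := centeredRep_mem b
  have hc' := centeredRep_mem c
  have key (x y : UnitAddCircle) (hx : x ≠ half) (hy : y ≠ half)
      (hxy : centeredRep x + centeredRep y = k) : centeredRep x + centeredRep y = 0 := by
    have h1 := centeredRep_lt_half hx
    have h2 := centeredRep_lt_half hy
    have h3 := centeredRep_mem x
    have h4 := centeredRep_mem y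
    have hk1 : (-1 : ℝ) < k := by linarith
    have hk2 : (k : ℝ) < 1 := by linarith
    have : k = 0 := by
      have : -1 < k := by exact_mod_cast hk1
      have : k < 1 := by exact_mod_cast hk2
      omega
    simpa [this] using hxy
  by_cases ha : a = half
  · have hb : b ≠ half := fun hb ↦ hne ⟨ha, hb⟩
    have hc : c ≠ half := by
      rintro rfl
      rw [add_eq_right] at h
      rw [ha, add_eq_zero_iff_neg_eq, neg_half] at h
      exact hb h.symm
    have h0 := centeredRep_eq_half_iff.mpr ha
    have := key b c hb hc (by linarith)
    simp only [sawtooth, ha, hb, hc, if_true, if_false, centeredRep_half]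
    linear_combination (centeredRep b + centeredRep c) * this
  by_cases hb : b = half
  · have hc : c ≠ half := by
      rintro rfl
      rw [add_eq_right] at h
      rw [hb, add_eq_zero_iff_eq_neg, neg_half] at h
      exact ha h
    have h0 := centeredRep_eq_half_iff.mpr hb
    have := key a c ha hc (by linarith)
    simp only [sawtooth, ha, hb, hc, if_true, if_false, centeredRep_half]
    linear_combination (centeredRep a + centeredRep c) * this
  by_cases hc : c = half
  · have h0 := centeredRep_eq_half_iff.mpr hc
    have := key a b ha hb (by linarith)
    simp only [sawtooth, ha, hb, hc, if_true, if_false, centeredRep_half]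
    linear_combination (centeredRep a + centeredRep b) * this
  have h1 := centeredRep_lt_half ha
  have h2 := centeredRep_lt_half hb
  have h3 := centeredRep_lt_half hc
  have hk1 : (-2 : ℝ) < k := by linarith
  have hk2 : (k : ℝ) < 1 := by linarith
  have hk3 : k = 0 ∨ k = -1 := by
    have : -2 < k := by exact_mod_cast hk1
    have : k < 1 := by exact_mod_cast hk2
    omega
  simp only [sawtooth, ha, hb, hc, if_false]
  rcases hk3 with rfl | rfl
  · push_cast at hk
    linear_combination (centeredRep a + centeredRep b + centeredRep c + 1 / 2) * hk
  · push_cast at hk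
    linear_combination (centeredRep a + centeredRep b + centeredRep c - 1 / 2) * hk

theorem permS_mem_paramOrbit {x y : Param} : permS y ∈ paramOrbit x ↔ y ∈ paramOrbit x := by
  let g : Subgroup.closure ({permS, permT} : Set (Equiv.Perm Param)) :=
    ⟨permS, Subgroup.subset_closure (by simp)⟩
  refine MulAction.orbit_eq_iff.symm.trans ((Eq.congr_left ?_).trans MulAction.orbit_eq_iff)
  exact MulAction.orbit_smul g y

theorem permT_mem_paramOrbit {x y : Param} : permT y ∈ paramOrbit x ↔ y ∈ paramOrbit x := by
  let g : Subgroup.closure ({permS, permT} : Set (Equiv.Perm Param)) :=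
    ⟨permT, Subgroup.subset_closure (by simp)⟩
  refine MulAction.orbit_eq_iff.symm.trans ((Eq.congr_left ?_).trans MulAction.orbit_eq_iff)
  exact MulAction.orbit_smul g y

theorem paramOrbit_eq_of_mem {x y : Param} (h : y ∈ paramOrbit x) :
    paramOrbit y = paramOrbit x :=
  MulAction.orbit_eq_iff.mpr h

theorem paramOrbit_subset {A : Set Param} (hS : ∀ x, permS x ∈ A ↔ x ∈ A)
    (hT : ∀ x, permT x ∈ A ↔ x ∈ A) {x : Param} (hx : x ∈ A) : paramOrbit x ⊆ A := by
  rintro _ ⟨⟨g, hg⟩, rfl⟩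
  have key : ∀ y, g y ∈ A ↔ y ∈ A := by
    induction hg using Subgroup.closure_induction with
    | mem g hg =>
      rcases hg with rfl | rfl
      · exact hS
      · exact hT
    | one => exact fun y ↦ Iff.rfl
    | mul g h _ _ ihg ihh => exact fun y ↦ (ihg (h y)).trans (ihh y)
    | inv g _ ih =>
      intro y
      rw [← ih (g⁻¹ y), show g (g⁻¹ y) = y from g.apply_symm_apply y]
  exact (key x).mpr hx

theorem half_half_notMem {x : Param} (h : paramOrbit x ≠ {(half, half)}) :
    (half, half) ∉ paramOrbit x := by
  intro hmem
  apply h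
  have hS : permS (half, half) = (half, half) := by simp [permS, neg_half]
  have hT : permT (half, half) = (half, half) := by
    simp [permT, half_add_half]
  rw [← paramOrbit_eq_of_mem hmem]
  refine Set.Subset.antisymm (paramOrbit_subset (A := {(half, half)}) (fun y ↦ ?_) (fun y ↦ ?_)
    (Set.mem_singleton _)) ?_
  · rw [Set.mem_singleton_iff, Set.mem_singleton_iff]
    conv_lhs => rw [← hS]
    exact permS.apply_eq_iff_eq
  · rw [Set.mem_singleton_iff, Set.mem_singleton_iff]
    conv_lhs => rw [← hT]
    exact permT.apply_eq_iff_eq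
  · rintro _ rfl
    exact MulAction.mem_orbit_self _

theorem disjoint_of_ne {x : Param} (h : paramOrbit x ≠ {(0, 0), (half, 0), (0, half)}) {y : Param}
    (hy : y ∈ paramOrbit x) : y ≠ (0, 0) ∧ y ≠ (half, 0) ∧ y ≠ (0, half) := by
  have hS0 : permS (0, 0) = (0, 0) := by simp [permS]
  have hS1 : permS (half, 0) = (0, half) := by simp [permS]
  have hS2 : permS (0, half) = (half, 0) := by simp [permS, neg_half]
  have hT0 : permT (0, 0) = (0, half) := by simp [permT]
  have hT1 : permT (half, 0) = (half, 0) := by simp [permT, half_add_half]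
  have hT2 : permT (0, half) = (0, 0) := by simp [permT, half_add_half]
  have h0 : (0, 0) ∉ paramOrbit x := by
    intro hmem
    apply h
    rw [← paramOrbit_eq_of_mem hmem]
    refine Set.Subset.antisymm (paramOrbit_subset (A := {(0, 0), (half, 0), (0, half)})
      (fun y ↦ ?_) (fun y ↦ ?_) (by simp)) ?_
    · simp only [Set.mem_insert_iff, Set.mem_singleton_iff]
      have e0 : permS y = (0, 0) ↔ y = (0, 0) := by
        conv_lhs => rw [← hS0]
        exact permS.apply_eq_iff_eq
      have e1 : permS y = (half, 0) ↔ y = (0, half) := by rw [← hS2, permS.apply_eq_iff_eq]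
      have e2 : permS y = (0, half) ↔ y = (half, 0) := by rw [← hS1, permS.apply_eq_iff_eq]
      rw [e0, e1, e2]
      tauto
    · simp only [Set.mem_insert_iff, Set.mem_singleton_iff]
      have e0 : permT y = (0, 0) ↔ y = (0, half) := by rw [← hT2, permT.apply_eq_iff_eq]
      have e1 : permT y = (half, 0) ↔ y = (half, 0) := by
        conv_lhs => rw [← hT1]
        exact permT.apply_eq_iff_eq
      have e2 : permT y = (0, half) ↔ y = (0, 0) := by rw [← hT0, permT.apply_eq_iff_eq]
      rw [e0, e1, e2]
      tauto
    · have m0 : (0, 0) ∈ paramOrbit ((0, 0) : Param) := MulAction.mem_orbit_self _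
      have m2 : (0, half) ∈ paramOrbit ((0, 0) : Param) := by
        rw [← hT0]; exact permT_mem_paramOrbit.mpr m0
      have m1 : (half, 0) ∈ paramOrbit ((0, 0) : Param) := by
        rw [← hS2]; exact permS_mem_paramOrbit.mpr m2
      rintro _ (rfl | rfl | rfl) <;> assumption
  refine ⟨?_, ?_, ?_⟩
  · rintro rfl; exact h0 hy
  · rintro rfl
    rw [← permS_mem_paramOrbit, hS1, ← permT_mem_paramOrbit, hT2] at hy
    exact h0 hy
  · rintro rfl
    rw [← permT_mem_paramOrbit, hT2] at hy
    exact h0 hy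

@[to_additive]
theorem prod_paramOrbit_permS {M : Type*} [CommMonoid M] {x : Param}
    (hfin : (paramOrbit x).Finite) (f : Param → M) :
    ∏ y ∈ hfin.toFinset, f (permS y) = ∏ y ∈ hfin.toFinset, f y :=
  Finset.prod_equiv permS (by simp [permS_mem_paramOrbit]) (fun _ _ ↦ rfl)

@[to_additive]
theorem prod_paramOrbit_permT {M : Type*} [CommMonoid M] {x : Param}
    (hfin : (paramOrbit x).Finite) (f : Param → M) :
    ∏ y ∈ hfin.toFinset, f (permT y) = ∏ y ∈ hfin.toFinset, f y :=
  Finset.prod_equiv permT (by simp [permT_mem_paramOrbit]) (fun _ _ ↦ rfl)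

theorem sum_centeredRep_sq {x : Param} (hfin : (paramOrbit x).Finite)
    (h : paramOrbit x ≠ {(half, half)}) :
    ∑ y ∈ hfin.toFinset, centeredRep y.1 ^ 2 = (paramOrbit x).ncard / 12 := by
  have hhalf := half_half_notMem h
  have hB : ∑ y ∈ hfin.toFinset, sawtooth y.1 * sawtooth y.2 = 0 := by
    have h1 := sum_paramOrbit_permS hfin fun y ↦ sawtooth y.1 * sawtooth y.2
    simp only [permS, Equiv.coe_fn_mk, sawtooth_neg] at h1
    have h2 : ∑ y ∈ hfin.toFinset, -sawtooth y.2 * sawtooth y.1 =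
        -∑ y ∈ hfin.toFinset, sawtooth y.1 * sawtooth y.2 := by
      rw [← Finset.sum_neg_distrib]
      exact Finset.sum_congr rfl fun y _ ↦ by ring
    linarith
  have hST (f : Param → ℝ) : ∑ y ∈ hfin.toFinset, f (half - y.1 - y.2, y.1) =
      ∑ y ∈ hfin.toFinset, f y := by
    rw [← sum_paramOrbit_permS hfin f, ← sum_paramOrbit_permT hfin fun y ↦ f (permS y)]
    refine Finset.sum_congr rfl fun y _ ↦ ?_
    congr 2
    simp only [permT, Equiv.coe_fn_mk, neg_add]
    rw [neg_half]
    abel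
  have hA2 : ∑ y ∈ hfin.toFinset, centeredRep y.2 ^ 2 =
      ∑ y ∈ hfin.toFinset, centeredRep y.1 ^ 2 := by
    rw [← sum_paramOrbit_permS hfin fun y ↦ centeredRep y.1 ^ 2]
    exact Finset.sum_congr rfl fun y _ ↦ (centeredRep_neg_sq y.2).symm
  have hA3 := hST fun y ↦ centeredRep y.1 ^ 2
  have hB2 := hST fun y ↦ sawtooth y.1 * sawtooth y.2
  have hB3 := hST fun y ↦ sawtooth (half - y.1 - y.2) * sawtooth y.1
  have hB3' : ∑ y ∈ hfin.toFinset,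
      sawtooth (half - (half - y.1 - y.2) - y.1) * sawtooth (half - y.1 - y.2) =
      ∑ y ∈ hfin.toFinset, sawtooth y.2 * sawtooth (half - y.1 - y.2) :=
    Finset.sum_congr rfl fun y _ ↦ by
      rw [show half - (half - y.1 - y.2) - y.1 = y.2 by abel]
  simp only at hA3 hB2 hB3
  have htot := Finset.sum_congr rfl fun y (hy : y ∈ hfin.toFinset) ↦
    sawtooth_identity (a := y.1) (b := y.2) (c := half - y.1 - y.2) (by abel) (by
      rintro ⟨h1, h2⟩
      have : y = (half, half) := Prod.ext h1 h2
      exact hhalf (this ▸ (Set.Finite.mem_toFinset hfin).mp hy))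
  simp only [Finset.sum_add_distrib, ← Finset.mul_sum, Finset.sum_const, nsmul_eq_mul] at htot
  rw [Set.ncard_eq_toFinset_card _ hfin]
  linarith

theorem even_ncard_paramOrbit {x : Param} (hfin : (paramOrbit x).Finite)
    (h₁ : paramOrbit x ≠ {(half, half)})
    (h₂ : paramOrbit x ≠ {(0, 0), (half, 0), (0, half)}) : Even (paramOrbit x).ncard := by
  have hsum : ∑ y ∈ hfin.toFinset, (1 : ZMod 2) = 0 := by
    refine Finset.sum_involution (fun y _ ↦ permS (permS y)) ?_ ?_ ?_ ?_
    · intros; decide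
    · intro y hy _ heq
      have hy' := (Set.Finite.mem_toFinset hfin).mp hy
      simp only [permS, Equiv.coe_fn_mk, Prod.ext_iff] at heq
      obtain ⟨ha, hb, hc⟩ := disjoint_of_ne h₂ hy'
      rcases eq_zero_or_half_of_neg_eq heq.1 with h | h <;>
        rcases eq_zero_or_half_of_neg_eq heq.2 with h' | h'
      · exact ha (Prod.ext h h')
      · exact hc (Prod.ext h h')
      · exact hb (Prod.ext h h')
      · exact half_half_notMem h₁ (show ((half, half) : Param) ∈ _ from
          (Prod.ext h h' : y = (half, half)) ▸ hy')
    · intro y hy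
      simpa [permS_mem_paramOrbit] using hy
    · intro y hy
      simp [permS]
  rw [Set.ncard_eq_toFinset_card _ hfin, ← ZMod.natCast_eq_zero_iff_even]
  simpa using hsum

end BianchiIX

end Orbits

section Theta

open Filter Topology Complex
open scoped Real UpperHalfPlane

theorem differentiableAt_jacobiTheta₂'_comp {f : ℂ → ℂ} (hf : Differentiable ℂ f) {τ : ℂ}
    (hτ : 0 < im τ) : DifferentiableAt ℂ (fun w ↦ jacobiTheta₂' (f w) w) τ := by
  obtain ⟨T, hT, hτ'⟩ := exists_between hτ
  obtain ⟨S, hS⟩ := exists_gt |im (f τ)|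
  have hU : IsOpen {w : ℂ | T < im w ∧ |im (f w)| < S} :=
    (isOpen_lt continuous_const continuous_im).inter
      (isOpen_lt (continuous_abs.comp (continuous_im.comp hf.continuous)) continuous_const)
  refine (differentiableOn_tsum_of_summable_norm
    (u := fun n : ℤ ↦ 2 * π * |n| * Real.exp (-π * (T * n ^ 2 - 2 * S * |n|))) ?_ ?_ hU
    fun n w hw ↦ norm_jacobiTheta₂'_term_le hT hw.2.le hw.1.le n).differentiableAt
    (hU.mem_nhds ⟨hτ', hS⟩)
  · simpa only [pow_one, mul_assoc] using
      (summable_pow_mul_jacobiTheta₂_term_bound S hT 1).mul_left (2 * π)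
  · intro n
    unfold jacobiTheta₂'_term jacobiTheta₂_term
    fun_prop

namespace BianchiIX

theorem thetaChar_eq_jacobiTheta₂ (p q τ : ℂ) :
    thetaChar p q 0 τ =
      cexp (π * I * p ^ 2 * τ + 2 * π * I * p * q) * jacobiTheta₂ (p * τ + q) τ := by
  rw [thetaChar, jacobiTheta₂, ← tsum_mul_left]
  refine tsum_congr fun m ↦ ?_
  rw [jacobiTheta₂_term, ← Complex.exp_add]
  congr 1
  ring

theorem dqTheta_eq_jacobiTheta₂ (p q : ℂ) {τ : ℂ} (hτ : 0 < im τ) :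
    dqTheta p q τ = cexp (π * I * p ^ 2 * τ + 2 * π * I * p * q) *
      (2 * π * I * p * jacobiTheta₂ (p * τ + q) τ + jacobiTheta₂' (p * τ + q) τ) := by
  have h1 : HasDerivAt (fun q' : ℂ ↦ cexp (π * I * p ^ 2 * τ + 2 * π * I * p * q'))
      (cexp (π * I * p ^ 2 * τ + 2 * π * I * p * q) * (2 * π * I * p)) q := by
    simpa using (((hasDerivAt_id q).const_mul (2 * π * I * p)).const_add
      (π * I * p ^ 2 * τ)).cexp
  have h2 : HasDerivAt (fun q' : ℂ ↦ jacobiTheta₂ (p * τ + q') τ)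
      (jacobiTheta₂' (p * τ + q) τ) q :=
    (hasDerivAt_jacobiTheta₂_fst (p * τ + q) hτ).comp_const_add (p * τ) q
  rw [dqTheta, funext fun q' ↦ thetaChar_eq_jacobiTheta₂ p q' τ, (h1.fun_mul h2).deriv]
  ring

theorem hasSum_dqTheta (p q : ℂ) {τ : ℂ} (hτ : 0 < im τ) :
    HasSum (fun m : ℤ ↦ 2 * π * I * (m + p) *
      cexp (π * I * (m + p) ^ 2 * τ + 2 * π * I * (m + p) * q)) (dqTheta p q τ) := by
  rw [dqTheta_eq_jacobiTheta₂ p q hτ]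
  refine ((((hasSum_jacobiTheta₂_term (p * τ + q) hτ).mul_left (2 * π * I * p)).add
    (hasSum_jacobiTheta₂'_term (p * τ + q) hτ)).mul_left _).congr_fun ?_
  intro m
  have : cexp (π * I * (m + p) ^ 2 * τ + 2 * π * I * (m + p) * q) =
      cexp (π * I * p ^ 2 * τ + 2 * π * I * p * q) * jacobiTheta₂_term m (p * τ + q) τ := by
    rw [jacobiTheta₂_term, ← Complex.exp_add]
    congr 1
    ring
  rw [this, jacobiTheta₂'_term]
  ring

theorem analyticAt_dqTheta (p q : ℂ) {τ : ℂ} (hτ : 0 < im τ) : AnalyticAt ℂ (dqTheta p q) τ := by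
  have hopen : IsOpen {w : ℂ | 0 < im w} := isOpen_lt continuous_const continuous_im
  refine DifferentiableOn.analyticAt (s := {w : ℂ | 0 < im w}) (fun w hw ↦ ?_)
    (hopen.mem_nhds hτ)
  refine DifferentiableAt.differentiableWithinAt (DifferentiableAt.congr_of_eventuallyEq ?_
    (f := fun w ↦ cexp (π * I * p ^ 2 * w + 2 * π * I * p * q) *
      (2 * π * I * p * jacobiTheta₂ (p * w + q) w + jacobiTheta₂' (p * w + q) w))
    ((hopen.eventually_mem hw).mono fun w' hw' ↦ dqTheta_eq_jacobiTheta₂ p q hw'))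
  have h1 : DifferentiableAt ℂ (fun w ↦ jacobiTheta₂ (p * w + q) w) w :=
    (hasFDerivAt_jacobiTheta₂ (p * w + q) hw).differentiableAt.comp w
      (f := fun w ↦ (p * w + q, w)) (by fun_prop)
  have h2 : DifferentiableAt ℂ (fun w ↦ jacobiTheta₂' (p * w + q) w) w :=
    differentiableAt_jacobiTheta₂'_comp (by fun_prop) hw
  fun_prop

theorem dqTheta_add_intCast_left (p q τ : ℂ) (k : ℤ) :
    dqTheta (p + k) q τ = dqTheta p q τ := by
  have (q' : ℂ) : thetaChar (p + k) q' 0 τ = thetaChar p q' 0 τ := by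
    rw [thetaChar, thetaChar, ← (Equiv.addRight k).tsum_eq fun m : ℤ ↦ cexp (_ * (m + p) ^ 2 * _ + _)]
    refine tsum_congr fun m ↦ ?_
    simp only [Equiv.coe_addRight, Int.cast_add]
    congr 1
    ring
  simp only [dqTheta, this]

theorem dqTheta_add_intCast_right (p q τ : ℂ) (k : ℤ) :
    dqTheta p (q + k) τ = cexp (2 * π * I * p * k) * dqTheta p q τ := by
  have (q' : ℂ) : thetaChar p (q' + k) 0 τ =
      cexp (2 * π * I * p * k) * thetaChar p q' 0 τ := by
    rw [thetaChar, thetaChar, ← tsum_mul_left]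
    refine tsum_congr fun m ↦ ?_
    rw [← Complex.exp_add, Complex.exp_eq_exp_iff_exists_int]
    exact ⟨m * k, by push_cast; ring⟩
  rw [dqTheta, dqTheta, ← deriv_comp_add_const]
  simp only [this, deriv_const_mul_field]

theorem dqTheta_add_one (p q τ : ℂ) :
    dqTheta p q (τ + 1) = cexp (-π * I * (p ^ 2 + p)) * dqTheta p (q + p + 1 / 2) τ := by
  have (q' : ℂ) : thetaChar p q' 0 (τ + 1) =
      cexp (-π * I * (p ^ 2 + p)) * thetaChar p (q' + (p + 1 / 2)) 0 τ := by
    rw [thetaChar, thetaChar, ← tsum_mul_left]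
    refine tsum_congr fun m ↦ ?_
    rw [← Complex.exp_add, Complex.exp_eq_exp_iff_exists_int]
    obtain ⟨k, hk⟩ := Int.even_mul_pred_self m
    refine ⟨k, ?_⟩
    have hk' : (m : ℂ) * (m - 1) = k + k := by exact_mod_cast hk
    linear_combination (π * I) * hk'
  rw [add_assoc, dqTheta, dqTheta, ← deriv_comp_add_const]
  simp only [this, deriv_const_mul_field]

theorem dqTheta_neg_inv (p q : ℂ) {τ : ℂ} (hτ : 0 < im τ) :
    dqTheta p q (-1 / τ) =
      cexp (2 * π * I * p * q) * (τ * (-I * τ) ^ (1 / 2 : ℂ)) * dqTheta q (-p) τ := by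
  have hτ0 : τ ≠ 0 := by rintro rfl; simp at hτ
  have hτ' : 0 < im (-1 / τ) := by
    rw [neg_div, neg_im, one_div, inv_im, neg_div, neg_neg]
    exact div_pos hτ (normSq_pos.mpr hτ0)
  have hs : (-I * τ) ^ (1 / 2 : ℂ) ≠ 0 := by
    rw [Ne, cpow_eq_zero_iff]
    simp [hτ0]
  rw [dqTheta_eq_jacobiTheta₂ p q hτ', dqTheta_eq_jacobiTheta₂ q (-p) hτ,
    jacobiTheta₂'_functional_equation (q * τ + -p) τ,
    jacobiTheta₂_functional_equation (q * τ + -p) τ,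
    show p * (-1 / τ) + q = (q * τ + -p) / τ by field_simp; ring]
  have he : cexp (π * I * p ^ 2 * (-1 / τ) + 2 * π * I * p * q) =
      cexp (2 * π * I * p * q) * cexp (π * I * q ^ 2 * τ + 2 * π * I * q * -p) *
        cexp (-π * I * (q * τ + -p) ^ 2 / τ) := by
    rw [← Complex.exp_add, ← Complex.exp_add]
    congr 1
    field_simp
    ring
  rw [he]
  field_simp
  ring

theorem exists_dqThetaAt_eq {p q : ℝ} {x : Param} (hp : (p : UnitAddCircle) = x.1)
    (hq : (q : UnitAddCircle) = x.2) :
    ∃ u : ℂ, u ≠ 0 ∧ ∀ τ, dqThetaAt x τ = u * dqTheta p q τ := by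
  have hrep (a : UnitAddCircle) : (rep a : UnitAddCircle) = a :=
    (AddCircle.equivIco (1 : ℝ) 0).symm_apply_apply a
  obtain ⟨k, hk⟩ := coe_eq_coe_iff_exists.mp ((hrep x.1).trans hp.symm)
  obtain ⟨l, hl⟩ := coe_eq_coe_iff_exists.mp ((hrep x.2).trans hq.symm)
  refine ⟨cexp (2 * π * I * p * l), Complex.exp_ne_zero _, fun τ ↦ ?_⟩
  rw [dqThetaAt, hk, hl]
  push_cast
  rw [dqTheta_add_intCast_left, dqTheta_add_intCast_right]

theorem exists_dqThetaAt_add_one (x : Param) :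
    ∃ u : ℂ, ∀ τ, dqThetaAt x (τ + 1) = u * dqThetaAt (permT x) τ := by
  have h1 := coe_centeredRep x.1
  have h2 := coe_centeredRep x.2
  obtain ⟨u, -, hxu⟩ := exists_dqThetaAt_eq h1 h2
  obtain ⟨v, hv, hxv⟩ := exists_dqThetaAt_eq (x := permT x) (p := centeredRep x.1)
    (q := centeredRep x.2 + centeredRep x.1 + 1 / 2) h1
    (by simp only [AddCircle.coe_add, h1, h2]; rfl)
  refine ⟨u * cexp (-π * I * ((centeredRep x.1 : ℂ) ^ 2 + centeredRep x.1)) / v,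
    fun τ ↦ ?_⟩
  rw [hxu, hxv, dqTheta_add_one]
  push_cast
  field_simp

theorem exists_dqThetaAt_neg_inv (x : Param) :
    ∃ u : ℂ, ∀ τ : ℂ, 0 < im τ → dqThetaAt x (-1 / τ) =
      u * (τ * (-I * τ) ^ (1 / 2 : ℂ)) * dqThetaAt (permS.symm x) τ := by
  have h1 := coe_centeredRep x.1
  have h2 := coe_centeredRep x.2
  obtain ⟨u, -, hxu⟩ := exists_dqThetaAt_eq h1 h2
  obtain ⟨v, hv, hxv⟩ := exists_dqThetaAt_eq (x := permS.symm x) (p := centeredRep x.2)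
    (q := -centeredRep x.1) h2 (by rw [AddCircle.coe_neg, h1]; rfl)
  refine ⟨u * cexp (2 * π * I * centeredRep x.1 * centeredRep x.2) / v,
    fun τ hτ ↦ ?_⟩
  rw [hxu, hxv, dqTheta_neg_inv _ _ hτ]
  push_cast
  field_simp

theorem tendsto_dqTheta_mul_exp (p q μ : ℝ) (hμ : ∀ m : ℤ, (m + p : ℝ) ≠ 0 → μ ≤ (m + p) ^ 2) :
    Tendsto (fun τ : ℍ ↦ dqTheta p q τ * cexp (-π * I * μ * τ)) UpperHalfPlane.atImInfty
      (𝓝 (∑' m : ℤ, if (m + p : ℝ) ^ 2 = μ then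
        2 * π * I * (m + p) * cexp (2 * π * I * (m + p) * q) else 0)) := by
  have hmul (m : ℤ) (τ : ℍ) : 2 * π * I * (m + p) *
      cexp (π * I * (m + p) ^ 2 * τ + 2 * π * I * (m + p) * q) * cexp (-π * I * μ * τ) =
      2 * π * I * (m + p) * cexp (2 * π * I * (m + p) * q) *
        cexp (π * I * ((m + p : ℝ) ^ 2 - μ : ℝ) * τ) := by
    rw [mul_assoc _ (cexp _), mul_assoc _ (cexp _), ← Complex.exp_add, ← Complex.exp_add]
    push_cast
    ring_nf
  have hterm (τ : ℍ) : dqTheta p q τ * cexp (-π * I * μ * τ) =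
      ∑' m : ℤ, 2 * π * I * (m + p) * cexp (2 * π * I * (m + p) * q) *
        cexp (π * I * ((m + p : ℝ) ^ 2 - μ : ℝ) * τ) := by
    rw [← (hasSum_dqTheta p q τ.im_pos).tsum_eq, ← tsum_mul_right]
    exact tsum_congr fun m ↦ hmul m τ
  simp only [hterm]
  have hnorm (m : ℤ) (τ : ℍ) : ‖cexp (π * I * ((m + p : ℝ) ^ 2 - μ : ℝ) * τ)‖ =
      Real.exp (-(π * ((m + p) ^ 2 - μ) * τ.im)) := by
    rw [Complex.norm_exp, show (π : ℂ) * I * ((m + p : ℝ) ^ 2 - μ : ℝ) * τ =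
      ((π * ((m + p) ^ 2 - μ) : ℝ) : ℂ) * (I * τ) by push_cast; ring, re_ofReal_mul, I_mul_re]
    simp
  refine tendsto_tsum_of_dominated_convergence (bound := fun m ↦
    ‖2 * π * I * (m + p) * cexp (2 * π * I * (m + p) * q) *
      cexp (π * I * ((m + p : ℝ) ^ 2 - μ : ℝ) * UpperHalfPlane.I)‖) ?_ ?_ ?_
  · refine Summable.norm ?_
    exact ((hasSum_dqTheta p q UpperHalfPlane.I.im_pos).summable.mul_right
      (cexp (-π * I * μ * UpperHalfPlane.I))).congr fun m ↦ hmul m UpperHalfPlane.I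
  · intro m
    split_ifs with h
    · simp [h]
    by_cases h0 : (m + p : ℝ) = 0
    · have : (m + p : ℂ) = 0 := by exact_mod_cast h0
      simp [this]
    have hpos : 0 < π * ((m + p) ^ 2 - μ) :=
      mul_pos Real.pi_pos (sub_pos.mpr (lt_of_le_of_ne (hμ m h0) (Ne.symm h)))
    rw [← mul_zero (2 * π * I * (m + p) * cexp (2 * π * I * (m + p) * q))]
    refine Tendsto.const_mul _ ?_
    rw [tendsto_zero_iff_norm_tendsto_zero]
    simp only [hnorm]
    exact Real.tendsto_exp_neg_atTop_nhds_zero.comp (Tendsto.const_mul_atTop hpos tendsto_comap)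
  · filter_upwards [(tendsto_comap (f := UpperHalfPlane.im)).eventually_ge_atTop 1] with τ hτ m
    by_cases h0 : (m + p : ℝ) = 0
    · have : (m + p : ℂ) = 0 := by exact_mod_cast h0
      simp [this]
    rw [norm_mul, norm_mul _ (cexp (_ * (UpperHalfPlane.I : ℂ))), hnorm, hnorm,
      UpperHalfPlane.I_im]
    have := mul_nonneg Real.pi_pos.le (sub_nonneg.mpr (hμ m h0))
    gcongr

/-- The order of `∂_q ϑ[p,q]` at `i∞`, as a power of `exp (π i τ)`. -/
noncomputable def cuspExponent (x : Param) : ℝ :=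
  open Classical in centeredRep x.1 ^ 2 + if x.1 = 0 then 1 else 0

theorem exists_intCast_eq_of_exp_eq {s t : ℝ} (h : cexp (2 * π * I * s) = cexp (2 * π * I * t)) :
    ∃ k : ℤ, s = t + k := by
  obtain ⟨k, hk⟩ := Complex.exp_eq_exp_iff_exists_int.mp h
  refine ⟨k, ?_⟩
  have h2 : (2 * π * I : ℂ) * s = 2 * π * I * (t + k : ℝ) := by
    rw [hk]
    push_cast
    ring
  exact_mod_cast mul_left_cancel₀ two_pi_I_ne_zero h2

theorem exists_tendsto_dqThetaAt {x : Param} (h0 : x ≠ (0, 0)) (h1 : x ≠ (half, 0))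
    (h2 : x ≠ (0, half)) : ∃ c : ℂ, c ≠ 0 ∧
      Tendsto (fun τ : ℍ ↦ dqThetaAt x τ * cexp (-π * I * cuspExponent x * τ))
        UpperHalfPlane.atImInfty (𝓝 c) := by
  set p := centeredRep x.1 with hp
  set q := centeredRep x.2 with hq
  obtain ⟨u, hu, hxu⟩ := exists_dqThetaAt_eq (coe_centeredRep x.1) (coe_centeredRep x.2)
  have hpmem := centeredRep_mem x.1
  rw [← hp] at hpmem
  have hint (m : ℤ) : m = 0 ∨ (m : ℝ) ≤ -1 ∨ 1 ≤ (m : ℝ) := by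
    rcases lt_trichotomy m 0 with h | h | h
    · exact Or.inr (Or.inl (by exact_mod_cast Int.le_sub_one_of_lt h))
    · exact Or.inl h
    · exact Or.inr (Or.inr (by exact_mod_cast h))
  have hμ (m : ℤ) (hm : (m + p : ℝ) ≠ 0) : cuspExponent x ≤ (m + p) ^ 2 := by
    by_cases hx : x.1 = 0
    · have hp0 : p = 0 := centeredRep_eq_zero_iff.mpr hx
      rw [cuspExponent, ← hp, hp0, if_pos hx]
      rw [hp0, add_zero] at hm
      rcases hint m with rfl | h | h
      · simp at hm
      · nlinarith
      · nlinarith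
    · rw [cuspExponent, if_neg hx, ← hp]
      rcases hint m with rfl | h | h
      · simp
      · nlinarith
      · nlinarith
  suffices hc : (∑' m : ℤ, if (m + p : ℝ) ^ 2 = cuspExponent x then
      2 * π * I * (m + p) * cexp (2 * π * I * (m + p) * q) else 0) ≠ 0 by
    refine ⟨_, mul_ne_zero hu hc, ?_⟩
    simp only [hxu, mul_assoc u]
    exact (tendsto_dqTheta_mul_exp p q _ hμ).const_mul u
  have hpi := two_pi_I_ne_zero
  by_cases hx : x.1 = 0
  · have hp0 : p = 0 := centeredRep_eq_zero_iff.mpr hx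
    rw [tsum_eq_sum (s := {1, -1}), Finset.sum_pair (by decide), cuspExponent, if_pos hx, ← hp, hp0]
    · norm_num
      intro h
      have h' : cexp (2 * π * I * q) = cexp (2 * π * I * (-q : ℝ)) := by
        apply mul_left_cancel₀ hpi
        push_cast
        rw [mul_neg]
        linear_combination h
      obtain ⟨k, hk⟩ := exists_intCast_eq_of_exp_eq h'
      have hqmem := centeredRep_mem x.2
      rw [← hq] at hqmem
      rcases hint k with rfl | h | h
      · exact h0 (Prod.ext hx (centeredRep_eq_zero_iff.mp (by
          rw [← hq]; push_cast at hk; linarith)))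
      · linarith
      · exact h2 (Prod.ext hx (centeredRep_eq_half_iff.mp (by rw [← hq]; linarith)))
    · intro m hm
      refine if_neg fun h ↦ hm ?_
      have h' : m ^ 2 = 1 := by
        rw [cuspExponent, if_pos hx, ← hp, hp0] at h
        have : (m : ℝ) ^ 2 = 1 := by linarith
        exact_mod_cast this
      simpa using h'
  have hp0 : p ≠ 0 := fun h ↦ hx (centeredRep_eq_zero_iff.mp h)
  have hexp : cuspExponent x = p ^ 2 := by rw [cuspExponent, if_neg hx, add_zero]
  have hiff (m : ℤ) : ((m + p : ℝ) ^ 2 = cuspExponent x) ↔ (m = 0 ∨ (m : ℝ) = -(2 * p)) := by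
    rw [hexp, ← sub_eq_zero, show (m + p : ℝ) ^ 2 - p ^ 2 = m * (m + 2 * p) by ring, mul_eq_zero,
      Int.cast_eq_zero, add_eq_zero_iff_eq_neg]
  simp only [hiff]
  by_cases hx' : x.1 = half
  · have hp2 : p = 1 / 2 := centeredRep_eq_half_iff.mpr hx'
    rw [tsum_eq_sum (s := {0, -1}), Finset.sum_pair (by decide), hp2]
    · norm_num
      intro h
      have h' : cexp (2 * π * I * (q / 2 : ℝ)) = cexp (2 * π * I * (-q / 2 : ℝ)) := by
        have hpi' : (π * I : ℂ) ≠ 0 := mul_ne_zero (by exact_mod_cast Real.pi_ne_zero) I_ne_zero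
        apply mul_left_cancel₀ hpi'
        push_cast
        ring_nf
        ring_nf at h
        linear_combination h
      obtain ⟨k, hk⟩ := exists_intCast_eq_of_exp_eq h'
      have hqmem := centeredRep_mem x.2
      rw [← hq] at hqmem
      rcases hint k with rfl | h | h
      · exact h1 (Prod.ext hx' (centeredRep_eq_zero_iff.mp (by
          rw [← hq]; push_cast at hk; linarith)))
      · linarith
      · linarith
    · intro m hm
      refine if_neg ?_
      rw [hp2]
      simp only [Finset.mem_insert, Finset.mem_singleton] at hm
      rintro (h | h)
      · exact hm (Or.inl h)
      · exact hm (Or.inr (by norm_num at h; exact_mod_cast h))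
  · have hlt := centeredRep_lt_half hx'
    rw [← hp] at hlt
    rw [tsum_eq_single 0]
    · simp [hp0, Real.pi_ne_zero]
    · intro m hm
      refine if_neg ?_
      rintro (h | h)
      · exact hm h
      · rcases hint m with h' | h' | h'
        · exact hm h'
        · linarith
        · linarith

theorem sum_cuspExponent {x : Param} (hfin : (paramOrbit x).Finite)
    (h : paramOrbit x ≠ {(half, half)}) :
    ∑ y ∈ hfin.toFinset, cuspExponent y =
      (paramOrbit x).ncard / 12 + {y | y ∈ paramOrbit x ∧ y.1 = 0}.ncard := by
  classical
  simp only [cuspExponent, Finset.sum_add_distrib, sum_centeredRep_sq hfin h, Finset.sum_boole]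
  congr 2
  rw [← Set.ncard_coe_finset]
  congr 1
  ext y
  simp

theorem analyticAt_dqThetaAt (x : Param) (τ : ℍ) : AnalyticAt ℂ (dqThetaAt x) τ :=
  analyticAt_dqTheta _ _ τ.im_pos

end BianchiIX

end Theta

section Main

open Filter Topology UpperHalfPlane ModularForm EisensteinSeries
open scoped MatrixGroups Manifold

namespace ModularForm

theorem denom_T (τ : ℍ) : denom ModularGroup.T τ = 1 := by
  rw [ModularGroup.denom_apply]
  simp [ModularGroup.T]

theorem exists_coe_eq_sq_of_transformation {F : ℍ → ℂ} {w : ℤ} (hw : Even w) (hF : MDiff F)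
    (hT : ∃ u : ℂ, ∀ τ, F (ModularGroup.T • τ) = u * F τ)
    (hS : ∃ u : ℂ, ∀ τ, F (ModularGroup.S • τ) = u * (τ : ℂ) ^ w * F τ)
    {c : ℂ} (hc : c ≠ 0) (hlim : Tendsto F atImInfty (𝓝 c)) :
    ∃ H : ModularForm 𝒮ℒ (2 * w), ⇑H = F ^ 2 := by
  obtain ⟨u, hu⟩ := hT
  obtain ⟨v, hv⟩ := hS
  have hTlim : Tendsto (fun τ : ℍ ↦ ModularGroup.T • τ) atImInfty atImInfty := by
    rw [atImInfty, tendsto_comap_iff]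
    refine tendsto_comap.congr fun τ ↦ ?_
    rw [Function.comp_apply, modular_T_smul, vadd_im]
  have hu1 : u = 1 := by
    have h1 := (hlim.comp hTlim).congr hu
    exact mul_right_cancel₀ hc ((tendsto_nhds_unique (hlim.const_mul u) h1).trans (one_mul c).symm)
  obtain ⟨τ₀, hτ₀⟩ := (hlim.eventually_ne hc).exists
  have hv1 : v ^ 2 = 1 := by
    have h1 := hv (ModularGroup.S • τ₀)
    have h2 : ModularGroup.S • ModularGroup.S • τ₀ = τ₀ := by
      ext1
      rw [modular_S_smul, modular_S_smul]
      simp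
    have h3 : ((ModularGroup.S • τ₀ : ℍ) : ℂ) = (-(τ₀ : ℂ))⁻¹ := by
      rw [modular_S_smul]
    rw [h2, hv τ₀, h3, inv_zpow, hw.neg_zpow] at h1
    have h4 : ((τ₀ : ℂ) ^ w) ≠ 0 := zpow_ne_zero _ τ₀.ne_zero
    field_simp at h1
    exact h1.symm
  refine ⟨ofLevelOne (F ^ 2) ?_ ?_ ?_ ?_, rfl⟩
  · ext τ
    rw [SL_slash_apply, ModularGroup.denom_S, Pi.pow_apply, hv, zpow_neg, two_mul, zpow_add₀ τ.ne_zero]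
    have h4 : ((τ : ℂ) ^ w) ≠ 0 := zpow_ne_zero _ τ.ne_zero
    field_simp
    rw [hv1, Pi.pow_apply, one_mul]
  · ext τ
    rw [SL_slash_apply, Pi.pow_apply, hu, hu1, denom_T, one_zpow, mul_one, one_mul, Pi.pow_apply]
  · exact hF.pow 2
  · exact (hlim.pow 2).isBigO_one ℝ

theorem tendsto_discriminant_mul_exp :
    Tendsto (fun τ : ℍ ↦ discriminant τ * Complex.exp (-(2 * Real.pi * Complex.I * τ)))
      atImInfty (𝓝 1) := by
  refine tendsto_atImInfty_tprod_one_sub_eta_q_pow.congr fun τ ↦ ?_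
  rw [discriminant_eq_q_prod, Function.Periodic.qParam, mul_right_comm, Complex.ofReal_one,
    div_one, ← Complex.exp_add, add_neg_cancel, Complex.exp_zero, one_mul]

end ModularForm

namespace BianchiIX

section Orbit

variable {x : Param} (hfin : (paramOrbit x).Finite)

theorem exists_prod_dqThetaAt_T_smul : ∃ u : ℂ, ∀ τ : ℍ,
    ∏ y ∈ hfin.toFinset, dqThetaAt y (ModularGroup.T • τ : ℍ) ^ 24 =
      u * ∏ y ∈ hfin.toFinset, dqThetaAt y τ ^ 24 := by
  choose u hu using exists_dqThetaAt_add_one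
  refine ⟨∏ y ∈ hfin.toFinset, u y ^ 24, fun τ ↦ ?_⟩
  rw [← prod_paramOrbit_permT hfin fun y ↦ dqThetaAt y τ ^ 24, ← Finset.prod_mul_distrib]
  refine Finset.prod_congr rfl fun y _ ↦ ?_
  rw [modular_T_smul, coe_vadd, Complex.ofReal_one, add_comm, hu, mul_pow]

theorem exists_prod_dqThetaAt_S_smul : ∃ u : ℂ, ∀ τ : ℍ,
    ∏ y ∈ hfin.toFinset, dqThetaAt y (ModularGroup.S • τ : ℍ) ^ 24 =
      u * (τ : ℂ) ^ (36 * (paramOrbit x).ncard) *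
        ∏ y ∈ hfin.toFinset, dqThetaAt y τ ^ 24 := by
  choose u hu using exists_dqThetaAt_neg_inv
  refine ⟨∏ y ∈ hfin.toFinset, u y ^ 24, fun τ ↦ ?_⟩
  have h := prod_paramOrbit_permS hfin fun y ↦ dqThetaAt (permS.symm y) τ ^ 24
  simp only [Equiv.symm_apply_apply] at h
  rw [h, Set.ncard_eq_toFinset_card _ hfin, pow_mul, ← Finset.prod_const, ← Finset.prod_mul_distrib,
    ← Finset.prod_mul_distrib]
  refine Finset.prod_congr rfl fun y _ ↦ ?_
  have h1 : ((ModularGroup.S • τ : ℍ) : ℂ) = -1 / τ := by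
    rw [modular_S_smul]
    simp [neg_div, inv_neg]
  have h2 : ((-Complex.I * τ) ^ (1 / 2 : ℂ)) ^ 24 = (τ : ℂ) ^ 12 := by
    rw [← Complex.cpow_nat_mul, show ((24 : ℕ) : ℂ) * (1 / 2) = (12 : ℕ) by norm_num,
      Complex.cpow_natCast, mul_pow, neg_pow, show (12 : ℕ) = 4 * 3 from rfl,
      pow_mul Complex.I, Complex.I_pow_four]
    norm_num
  rw [h1, hu y τ τ.im_pos, mul_pow, mul_pow, mul_pow, h2]
  ring

theorem exists_tendsto_prod_dqThetaAt (h₁ : paramOrbit x ≠ {(half, half)})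
    (h₂ : paramOrbit x ≠ {(0, 0), (half, 0), (0, half)}) : ∃ c : ℂ, c ≠ 0 ∧
    Tendsto (fun τ : ℍ ↦ (∏ y ∈ hfin.toFinset, dqThetaAt y τ ^ 24) /
      discriminant τ ^ ((paramOrbit x).ncard + 12 * {y | y ∈ paramOrbit x ∧ y.1 = 0}.ncard))
      atImInfty (𝓝 c) := by
  set K := (paramOrbit x).ncard + 12 * {y | y ∈ paramOrbit x ∧ y.1 = 0}.ncard with hK
  have hlim (y : Param) : ∃ c : ℂ, y ∈ paramOrbit x → c ≠ 0 ∧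
      Tendsto (fun τ : ℍ ↦ dqThetaAt y τ *
        Complex.exp (-Real.pi * Complex.I * cuspExponent y * τ)) atImInfty (𝓝 c) := by
    by_cases hy : y ∈ paramOrbit x
    · obtain ⟨h3, h4, h5⟩ := disjoint_of_ne h₂ hy
      obtain ⟨c, hc⟩ := exists_tendsto_dqThetaAt h3 h4 h5
      exact ⟨c, fun _ ↦ hc⟩
    · exact ⟨0, fun h ↦ absurd h hy⟩
  choose c hc using hlim
  have hmem {y : Param} (hy : y ∈ hfin.toFinset) : y ∈ paramOrbit x :=
    (Set.Finite.mem_toFinset hfin).mp hy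
  refine ⟨∏ y ∈ hfin.toFinset, c y ^ 24, Finset.prod_ne_zero_iff.mpr fun y hy ↦
    pow_ne_zero _ (hc y (hmem hy)).1, ?_⟩
  have h1 : Tendsto (fun τ : ℍ ↦ ∏ y ∈ hfin.toFinset, (dqThetaAt y τ *
      Complex.exp (-Real.pi * Complex.I * cuspExponent y * τ)) ^ 24) atImInfty
      (𝓝 (∏ y ∈ hfin.toFinset, c y ^ 24)) :=
    tendsto_finsetProd _ fun y hy ↦ (hc y (hmem hy)).2.pow 24
  have h2 := h1.div (tendsto_discriminant_mul_exp.pow K) (by simp)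
  rw [one_pow, div_one] at h2
  refine h2.congr fun τ ↦ ?_
  have hexp : ∏ y ∈ hfin.toFinset,
      Complex.exp (-Real.pi * Complex.I * cuspExponent y * τ) ^ 24 =
      Complex.exp (-(2 * Real.pi * Complex.I * τ)) ^ K := by
    simp only [← Complex.exp_nat_mul]
    rw [← Complex.exp_sum]
    congr 1
    have hsum : ∑ y ∈ hfin.toFinset, (cuspExponent y : ℂ) = K / 12 := by
      rw [← Complex.ofReal_sum, sum_cuspExponent hfin h₁, hK]
      push_cast
      ring
    have : ∀ y ∈ hfin.toFinset, ((24 : ℕ) : ℂ) *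
        (-Real.pi * Complex.I * cuspExponent y * τ) =
        (-24 * Real.pi * Complex.I * τ) * cuspExponent y := fun y _ ↦ by push_cast; ring
    rw [Finset.sum_congr rfl this, ← Finset.mul_sum, hsum]
    ring
  simp only [mul_pow, Finset.prod_mul_distrib, hexp, Pi.div_apply]
  exact mul_div_mul_right _ _ (pow_ne_zero _ (Complex.exp_ne_zero _))

/-- The product of the functions `∂_q ϑ[p',q'] ^ 48` over an orbit is a power of the discriminant
times a polynomial in the `j`-invariant. -/
theorem exists_prod_dqThetaAt_eq (h₁ : paramOrbit x ≠ {(half, half)})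
    (h₂ : paramOrbit x ≠ {(0, 0), (half, 0), (0, half)}) :
    ∃ (Q : Polynomial ℂ) (M : ℕ), Q ≠ 0 ∧
      (Q.natDegree : ℤ) = 4 * (paramOrbit x).ncard -
        24 * {y | y ∈ paramOrbit x ∧ y.1 = 0}.ncard ∧
      ∀ τ : ℍ, ∏ y ∈ hfin.toFinset, dqThetaAt y τ ^ 48 =
        discriminant τ ^ M * Q.eval (jInv τ) := by
  obtain ⟨c, hc, hlim⟩ := exists_tendsto_prod_dqThetaAt hfin h₁ h₂
  set n := (paramOrbit x).ncard
  set n₀ := {y | y ∈ paramOrbit x ∧ y.1 = 0}.ncard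
  set K := n + 12 * n₀ with hK
  set F : ℍ → ℂ := fun τ ↦ (∏ y ∈ hfin.toFinset, dqThetaAt y τ ^ 24) / discriminant τ ^ K with hF
  have hMD : MDiff F := by
    rw [mdifferentiable_iff]
    intro z hz
    have h1 : AnalyticAt ℂ (fun w ↦ (∏ y ∈ hfin.toFinset, dqThetaAt y w ^ 24) *
        ((discriminant (ofComplex w))⁻¹) ^ K) z :=
      (Finset.analyticAt_fun_prod _ fun y _ ↦ (analyticAt_dqThetaAt y ⟨z, hz⟩).fun_pow 24).fun_mul
        ((analyticAt_inv_discriminant ⟨z, hz⟩).fun_pow K)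
    refine (h1.differentiableAt.congr_of_eventuallyEq ?_).differentiableWithinAt
    filter_upwards [isOpen_upperHalfPlaneSet.mem_nhds hz] with w hw
    simp [hF, ofComplex_apply_of_im_pos hw, div_eq_mul_inv]
  have hT : ∃ u : ℂ, ∀ τ, F (ModularGroup.T • τ) = u * F τ := by
    obtain ⟨u, hu⟩ := exists_prod_dqThetaAt_T_smul hfin
    refine ⟨u, fun τ ↦ ?_⟩
    have : discriminant (ModularGroup.T • τ) = discriminant τ := by
      rw [discriminant_smul, denom_T]
      norm_num
    simp only [hF, hu, this]
    ring
  have hS : ∃ u : ℂ, ∀ τ : ℍ, F (ModularGroup.S • τ) =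
      u * (τ : ℂ) ^ (36 * n - 12 * K : ℤ) * F τ := by
    obtain ⟨u, hu⟩ := exists_prod_dqThetaAt_S_smul hfin
    refine ⟨u, fun τ ↦ ?_⟩
    have : discriminant (ModularGroup.S • τ) = (τ : ℂ) ^ 12 * discriminant τ := by
      rw [discriminant_smul, ModularGroup.denom_S]
      norm_cast
    have h0 := τ.ne_zero
    have hz : (τ : ℂ) ^ (36 * n - 12 * K : ℤ) = (τ : ℂ) ^ (36 * n) / ((τ : ℂ) ^ 12) ^ K := by
      rw [zpow_sub₀ h0, ← pow_mul, ← zpow_natCast, ← zpow_natCast]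
      push_cast
      rfl
    simp only [hF, hu, this, hz, mul_pow]
    rw [mul_div_mul_comm, mul_div_assoc]
  obtain ⟨H, hH⟩ := exists_coe_eq_sq_of_transformation (by
    rw [show (36 * n - 12 * K : ℤ) = 2 * (18 * n - 6 * K) by ring]
    exact even_two_mul _) hMD hT hS hc hlim
  have hHlim : (qExpansion 1 H).coeff 0 = c ^ 2 :=
    tendsto_nhds_unique (tendsto_levelOne_atImInfty H) (hH ▸ hlim.pow 2)
  have hweight : 0 ≤ 2 * (36 * n - 12 * K : ℤ) := by
    by_contra! hneg
    have h0 := ModularFormClass.levelOne_neg_weight_eq_zero hneg H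
    have h1 := tendsto_levelOne_atImInfty H
    rw [hHlim, h0] at h1
    exact pow_ne_zero 2 hc (tendsto_nhds_unique h1 tendsto_const_nhds)
  obtain ⟨M, hM⟩ := Int.eq_ofNat_of_zero_le (show 0 ≤ (4 * n - 24 * n₀ : ℤ) by
    rw [hK] at hweight; push_cast at hweight; omega)
  obtain ⟨Q, hQdeg, hQcoeff, hQ⟩ := exists_eq_discriminant_pow_mul_eval_jInv M
    (by rw [hK, ← hM]; push_cast; ring) H
  have hQM : Q.coeff M ≠ 0 := by rw [hQcoeff, hHlim]; exact pow_ne_zero 2 hc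
  refine ⟨Q, 2 * K + M, fun h ↦ hQM (by simp [h]), ?_, fun τ ↦ ?_⟩
  · rw [hM, le_antisymm hQdeg (Polynomial.le_natDegree_of_ne_zero hQM)]
  · have h1 := hQ τ
    rw [hH, Pi.pow_apply, div_pow, div_eq_iff (pow_ne_zero _ (pow_ne_zero _
      (discriminant_ne_zero τ))), ← Finset.prod_pow] at h1
    simp only [← pow_mul, Nat.reduceMul] at h1
    rw [h1]
    ring

theorem analyticOrderAt_prod_dqThetaAt_pow (τ : ℍ) :
    analyticOrderAt (fun w ↦ ∏ y ∈ hfin.toFinset, dqThetaAt y w ^ 48) τ =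
      ∑ y ∈ hfin.toFinset, 48 * zeroOrder y τ := by
  classical
  induction hfin.toFinset using Finset.induction_on with
  | empty =>
    simp only [Finset.prod_empty, Finset.sum_empty]
    exact (analyticAt_const.analyticOrderAt_eq_zero).mpr one_ne_zero
  | insert y s hy ih =>
    rw [Finset.sum_insert hy, ← ih, zeroOrder]
    simp only [Finset.prod_insert hy]
    have h1 := analyticAt_dqThetaAt y τ
    have h2 : AnalyticAt ℂ (fun w ↦ ∏ y ∈ s, dqThetaAt y w ^ 48) τ :=
      Finset.analyticAt_fun_prod _ fun y _ ↦ (analyticAt_dqThetaAt y τ).fun_pow 48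
    have h3 := analyticOrderAt_mul (h1.pow 48) h2
    rw [analyticOrderAt_pow h1, nsmul_eq_mul] at h3
    exact_mod_cast h3

end Orbit

theorem sum_zeroOrder_dqThetaAt {x : Param}
    (hfin : (paramOrbit x).Finite)
    (h₁ : paramOrbit x ≠
      {(half, half)})
    (h₂ : paramOrbit x ≠
      {(0, 0), (half, 0), (0, half)}) :
    Even (paramOrbit x).ncard ∧
    (∀ y ∈ paramOrbit x,
      ∀ τ : ℍ,
        AnalyticAt ℂ (dqThetaAt y) (τ : ℂ) ∧ zeroOrder y τ ≠ ⊤) ∧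
    ∀ R : Set ℍ, IsFundamentalSet R →
      (∀ y ∈ paramOrbit x,
        {P | P ∈ R ∧ zeroOrder y P ≠ 0}.Finite) ∧
      ∑ y ∈ hfin.toFinset,
        ((1 / 2 : ℚ) * ((zeroOrder y I).toNat : ℚ) +
          (1 / 3 : ℚ) * ((zeroOrder y ρ).toNat : ℚ) +
          ∑ᶠ P ∈ nonElliptic R, ((zeroOrder y P).toNat : ℚ)) =
      ((paramOrbit x).ncard : ℚ) / 12 -
        ({y | y ∈ paramOrbit x ∧
          y.1 = 0}.ncard : ℚ) / 2 := by
  obtain ⟨Q, M, hQ, hdeg, hprod⟩ := exists_prod_dqThetaAt_eq hfin h₁ h₂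
  have hord := analyticOrderAt_prod_dqThetaAt_pow hfin
  have htop (y : Param) (hy : y ∈ hfin.toFinset) (τ : ℍ) : zeroOrder y τ ≠ ⊤ := by
    have h1 : ∑ y ∈ hfin.toFinset, 48 * zeroOrder y τ ≠ ⊤ := by
      rw [← hord, analyticOrderAt_eval_jInv Q hQ M hprod]
      exact WithTop.mul_ne_top (ENat.natCast_ne_top _) (jRamification_ne_top τ)
    intro h
    refine h1 (top_le_iff.mp ?_)
    calc ⊤ = 48 * zeroOrder y τ := by rw [h]; rfl
      _ ≤ _ := Finset.single_le_sum (f := fun y ↦ 48 * zeroOrder y τ) (fun _ _ ↦ zero_le) hy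
  refine ⟨even_ncard_paramOrbit hfin h₁ h₂, fun y hy τ ↦ ⟨analyticAt_dqThetaAt y τ,
    htop y ((Set.Finite.mem_toFinset hfin).mpr hy) τ⟩, fun R hR ↦ ?_⟩
  obtain ⟨hfinite, hsum⟩ := valence_formula_eval_jInv Q hQ M
    (f := fun w ↦ ∏ y ∈ hfin.toFinset, dqThetaAt y w ^ 48) hprod hR
  have hzeros (y : Param) (hy : y ∈ hfin.toFinset) :
      {P | P ∈ R ∧ zeroOrder y P ≠ 0}.Finite := by
    refine hfinite.subset fun P hP ↦ ⟨hP.1, ?_⟩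
    rw [hord]
    intro h
    rw [Finset.sum_eq_zero_iff] at h
    simpa using (mul_eq_zero.mp (h y hy)).resolve_left (by norm_num) |> hP.2
  refine ⟨fun y hy ↦ hzeros y ((Set.Finite.mem_toFinset hfin).mpr hy), ?_⟩
  have hnat (τ : ℍ) :
      ((analyticOrderAt (fun w ↦ ∏ y ∈ hfin.toFinset, dqThetaAt y w ^ 48) (τ : ℂ)).toNat : ℚ) =
        ∑ y ∈ hfin.toFinset, 48 * ((zeroOrder y τ).toNat : ℚ) := by
    have : ∑ y ∈ hfin.toFinset, 48 * zeroOrder y τ =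
        ((∑ y ∈ hfin.toFinset, 48 * (zeroOrder y τ).toNat : ℕ) : ℕ∞) := by
      push_cast
      exact Finset.sum_congr rfl fun y hy ↦ by rw [ENat.natCast_toNat (htop y hy τ)]
    rw [hord, this, ENat.toNat_natCast]
    push_cast
    rfl
  have hfinsum : ∑ᶠ P ∈ nonElliptic R, ∑ y ∈ hfin.toFinset, 48 * ((zeroOrder y P).toNat : ℚ) =
      ∑ y ∈ hfin.toFinset, 48 * ∑ᶠ P ∈ nonElliptic R, ((zeroOrder y P).toNat : ℚ) := by
    have hsupp (y : Param) (hy : y ∈ hfin.toFinset) :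
        (Function.support fun P ↦ ∑ᶠ (_ : P ∈ nonElliptic R),
          48 * ((zeroOrder y P).toNat : ℚ)).Finite := by
      refine (hzeros y hy).subset fun P hP ↦ ?_
      rw [Function.mem_support] at hP
      by_cases hPR : P ∈ nonElliptic R
      · refine ⟨hPR.1, fun h ↦ hP ?_⟩
        simp [h]
      · simp [hPR] at hP
    have h1 (P : ℍ) : (∑ᶠ (_ : P ∈ nonElliptic R), ∑ y ∈ hfin.toFinset,
        48 * ((zeroOrder y P).toNat : ℚ)) = ∑ y ∈ hfin.toFinset, ∑ᶠ (_ : P ∈ nonElliptic R),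
        48 * ((zeroOrder y P).toNat : ℚ) := by
      by_cases hPR : P ∈ nonElliptic R <;> simp [hPR]
    rw [finsum_congr h1, finsum_sum_comm _ _ hsupp]
    refine Finset.sum_congr rfl fun y hy ↦ ?_
    rw [← smul_eq_mul, smul_finsum]
    exact finsum_congr fun P ↦ by rw [smul_finsum]; rfl
  simp only [hnat] at hsum
  rw [hfinsum] at hsum
  have hdeg' : (Q.natDegree : ℚ) = 4 * ((paramOrbit x).ncard : ℚ) -
      24 * ({y | y ∈ paramOrbit x ∧ y.1 = 0}.ncard : ℚ) := by exact_mod_cast hdeg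
  rw [hdeg'] at hsum
  simp only [Finset.sum_add_distrib, ← Finset.mul_sum] at hsum ⊢
  linarith

end BianchiIX

end Main

theorem mainTheorem12 (p q : ℝ)
    (hfin : (BianchiIX.paramOrbit ((p : UnitAddCircle), (q : UnitAddCircle))).Finite)
    (h₁ : BianchiIX.paramOrbit ((p : UnitAddCircle), (q : UnitAddCircle)) ≠
      {(BianchiIX.half, BianchiIX.half)})
    (h₂ : BianchiIX.paramOrbit ((p : UnitAddCircle), (q : UnitAddCircle)) ≠
      {(0, 0), (BianchiIX.half, 0), (0, BianchiIX.half)}) :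
    Even (BianchiIX.paramOrbit ((p : UnitAddCircle), (q : UnitAddCircle))).ncard ∧
    (∀ x ∈ BianchiIX.paramOrbit ((p : UnitAddCircle), (q : UnitAddCircle)),
      ∀ τ : UpperHalfPlane,
        AnalyticAt ℂ (BianchiIX.dqThetaAt x) (τ : ℂ) ∧ BianchiIX.zeroOrder x τ ≠ ⊤) ∧
    ∀ R : Set UpperHalfPlane, BianchiIX.IsFundamentalSet R →
      (∀ x ∈ BianchiIX.paramOrbit ((p : UnitAddCircle), (q : UnitAddCircle)),
        {P | P ∈ R ∧ BianchiIX.zeroOrder x P ≠ 0}.Finite) ∧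
      ∑ x ∈ hfin.toFinset,
        ((1 / 2 : ℚ) * ((BianchiIX.zeroOrder x UpperHalfPlane.I).toNat : ℚ) +
          (1 / 3 : ℚ) * ((BianchiIX.zeroOrder x UpperHalfPlane.ρ).toNat : ℚ) +
          ∑ᶠ P ∈ BianchiIX.nonElliptic R, ((BianchiIX.zeroOrder x P).toNat : ℚ)) =
      ((BianchiIX.paramOrbit ((p : UnitAddCircle), (q : UnitAddCircle))).ncard : ℚ) / 12 -
        ({x | x ∈ BianchiIX.paramOrbit ((p : UnitAddCircle), (q : UnitAddCircle)) ∧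
          x.1 = 0}.ncard : ℚ) / 2 :=
  BianchiIX.sum_zeroOrder_dqThetaAt hfin h₁ h₂
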